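/- Let $K$ be a field and $n\ge 2$. Let $\Lambda^*=K\langle x_1^*,\dots,x_n^*\rangle$ be the free associative $K$-algebra, let $I^*=\sum_i\Lambda^*x_i^*$, and call $\Lambda^*/I^*\cong K$ the trivial $\Lambda^*$-module. Let $\mathbb L=L_K(1,n)$ be the Leavitt algebra, i.e. the $K$-algebra generated by $x_i,x_i^*$ $(1\le i\le n)$ with relations $\sum_i x_ix_i^*=1$, $x_i^*x_i=1$ and $x_j^*x_i=0$ for $j\ne i$; it is a right $\Lambda^*$-module through the canonical homomorphism $\Lambda^*\to\mathbb L$. All modules are left modules. Let $\mathfrak{FD}$ be the category of $\Lambda^*$-modules that are finite-dimensional over $K$, and $\mathfrak{FPL}$ the category of finitely presented $\mathbb L$-modules of finite length. A module $M\in\mathfrak{FD}$ is called a Leavitt module if no simple subfactor $P/N$ ($N\le P\le M$) is isomorphic to the trivial module, and a Leavitt-torsion module if every simple subfactor is isomorphic to the trivial module. The Leavitt category is the full subcategory of Leavitt modules. Then: 1. If $M\in\mathfrak{FD}$, then $\mathbb L\otimes_{\Lambda^*}M\in\mathfrak{FPL}$. The Leavitt-torsion modules form a Serre subcategory $\mathfrak{LT}$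 of the abelian category $\mathfrak{FD}$, and the functor $\mathfrak{FD}\to\mathfrak{FPL}$, $M\mapsto\mathbb L\otimes_{\Lambda^*}M$, exhibits $\mathfrak{FPL}$ as the quotient category $\mathfrak{FD}/\mathfrak{LT}$, i.e. as the localization of $\mathfrak{FD}$ at the morphisms whose kernel and cokernel are Leavitt-torsion. 2. The restriction of this functor to the Leavitt category is full and faithful. In particular, for every Leavitt module $M$ the map $f\mapsto\mathbb L\otimes f$ is an isomorphism of $K$-algebras $\operatorname{End}_{\Lambda^*}(M)\cong\operatorname{End}_{\mathbb L}(\mathbb L\otimes_{\Lambda^*}M)$. 3. Let $\pi\colon\Lambda^*\to A$ be a surjective homomorphism onto a finite-dimensional $K$-algebra $A$ with $\pi(I^*)=A$. Then $M\mapsto\mathbb L\otimes_{\Lambda^*}M$, where $\Lambda^*$ acts on $M$ through $\pi$, is a full and faithful functor from the category of finite-dimensional $A$-modules to $\mathfrak{FPL}$. -/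

import Mathlib

open CategoryTheory
open scoped TensorProduct ModuleCat

universe u

noncomputable section

/-! ## Extension of scalars along a homomorphism of noncommutative rings -/

section ExtendScalars

variable {R S : Type u} [Ring R] [Ring S] (φ : R →+* S)

/-- The `S`-submodule of `S ⊗[ℤ] M` that is generated by all `s φ(r) ⊗ m - s ⊗ r m`. -/
def tensorRelations (M : Type u) [AddCommGroup M] [Module R M] : Submodule S (S ⊗[ℤ] M) :=
  Submodule.span S {z | ∃ (s : S) (r : R) (m : M), z = (s * φ r) ⊗ₜ[ℤ] m - s ⊗ₜ[ℤ] (r • m)}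

/-- The left `S`-module `S ⊗_R M`, where `S` is a right `R`-module through `φ : R →+* S`. -/
def TensorOver (M : Type u) [AddCommGroup M] [Module R M] : Type u :=
  (S ⊗[ℤ] M) ⧸ tensorRelations φ M

instance (M : Type u) [AddCommGroup M] [Module R M] : AddCommGroup (TensorOver φ M) :=
  inferInstanceAs (AddCommGroup ((S ⊗[ℤ] M) ⧸ tensorRelations φ M))

instance (M : Type u) [AddCommGroup M] [Module R M] : Module S (TensorOver φ M) :=
  inferInstanceAs (Module S ((S ⊗[ℤ] M) ⧸ tensorRelations φ M))

/-- The class of the pure tensor `s ⊗ m` in `S ⊗_R M`. -/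
def TensorOver.tmul {M : Type u} [AddCommGroup M] [Module R M] (s : S) (m : M) :
    TensorOver φ M :=
  (tensorRelations φ M).mkQ (s ⊗ₜ[ℤ] m)

theorem tensorRelations_le_comap {M N : Type u} [AddCommGroup M] [Module R M]
    [AddCommGroup N] [Module R N] (f : M →ₗ[R] N) :
    tensorRelations φ M ≤ (tensorRelations φ N).comap
      (TensorProduct.AlgebraTensorModule.map (LinearMap.id : S →ₗ[S] S)
        f.toAddMonoidHom.toIntLinearMap) := by
  refine Submodule.span_le.2 ?_
  rintro _ ⟨s, r, m, rfl⟩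
  refine Submodule.subset_span ⟨s, r, f m, ?_⟩
  simp

/-- The `S`-linear map `S ⊗ f : S ⊗_R M → S ⊗_R N`, `s ⊗ m ↦ s ⊗ f m`. -/
def TensorOver.map {M N : Type u} [AddCommGroup M] [Module R M]
    [AddCommGroup N] [Module R N] (f : M →ₗ[R] N) : TensorOver φ M →ₗ[S] TensorOver φ N :=
  Submodule.mapQ (tensorRelations φ M) (tensorRelations φ N)
    (TensorProduct.AlgebraTensorModule.map (LinearMap.id : S →ₗ[S] S)
      f.toAddMonoidHom.toIntLinearMap)
    (tensorRelations_le_comap φ f)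

@[simp]
theorem TensorOver.map_tmul {M N : Type u} [AddCommGroup M] [Module R M]
    [AddCommGroup N] [Module R N] (f : M →ₗ[R] N) (s : S) (m : M) :
    TensorOver.map φ f (TensorOver.tmul φ s m) = TensorOver.tmul φ s (f m) := rfl

theorem TensorOver.hom_ext {M N : Type u} [AddCommGroup M] [Module R M]
    [AddCommGroup N] [Module S N] {f g : TensorOver φ M →ₗ[S] N}
    (h : ∀ s m, f (TensorOver.tmul φ s m) = g (TensorOver.tmul φ s m)) : f = g := by
  refine Submodule.linearMap_qext (tensorRelations φ M) (TensorProduct.AlgebraTensorModule.ext fun s m => ?_)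
  exact h s m

/-- The functor `M ↦ S ⊗_R M` from left `R`-modules to left `S`-modules. -/
def tensorFunctor : ModuleCat.{u} R ⥤ ModuleCat.{u} S where
  obj M := ModuleCat.of S (TensorOver φ M)
  map f := ModuleCat.ofHom (TensorOver.map φ f.hom)
  map_id M := by
    ext1
    exact TensorOver.hom_ext φ (fun s m => by simp)
  map_comp f g := by
    ext1
    exact TensorOver.hom_ext φ (fun s m => by simp)

end ExtendScalars

/-! ## The Leavitt algebra -/

section Leavitt

variable (K : Type u) [Field K] (n : ℕ)

/-- The free algebra `Λ* = K⟨x₁*, …, xₙ*⟩`; the variable `xᵢ*` is `FreeAlgebra.ι K i`. -/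
abbrev LambdaStar : Type u := FreeAlgebra K (Fin n)

/-- The defining relations `∑ᵢ xᵢ xᵢ* = 1`, `xᵢ* xᵢ = 1` and `xⱼ* xᵢ = 0` for `j ≠ i`.
In the free algebra on `Fin n ⊕ Fin n` the generator `inl i` is `xᵢ` and `inr i` is `xᵢ*`. -/
inductive LeavittRel : FreeAlgebra K (Fin n ⊕ Fin n) → FreeAlgebra K (Fin n ⊕ Fin n) → Prop
  | sum : LeavittRel
      (∑ i : Fin n, FreeAlgebra.ι K (Sum.inl i) * FreeAlgebra.ι K (Sum.inr i)) 1
  | same (i : Fin n) : LeavittRel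
      (FreeAlgebra.ι K (Sum.inr i) * FreeAlgebra.ι K (Sum.inl i)) 1
  | diff (i j : Fin n) : j ≠ i → LeavittRel
      (FreeAlgebra.ι K (Sum.inr j) * FreeAlgebra.ι K (Sum.inl i)) 0

/-- The Leavitt algebra `𝕃 = L_K(1, n)`. -/
def LeavittAlgebra : Type u := RingQuot (LeavittRel K n)

instance : Ring (LeavittAlgebra K n) := inferInstanceAs (Ring (RingQuot (LeavittRel K n)))

instance : Algebra K (LeavittAlgebra K n) :=
  inferInstanceAs (Algebra K (RingQuot (LeavittRel K n)))

/-- The canonical projection from the free algebra on all `xᵢ`, `xᵢ*` onto `𝕃`. -/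
def leavittProj : FreeAlgebra K (Fin n ⊕ Fin n) →ₐ[K] LeavittAlgebra K n :=
  RingQuot.mkAlgHom K (LeavittRel K n)

/-- The canonical algebra homomorphism `Λ* → 𝕃` with `xᵢ* ↦ xᵢ*`. -/
def lambdaStarToLeavitt : LambdaStar K n →ₐ[K] LeavittAlgebra K n :=
  FreeAlgebra.lift K fun i => leavittProj K n (FreeAlgebra.ι K (Sum.inr i))

/-- The ideal `I* = ∑ᵢ Λ* xᵢ*`. -/
def augIdeal : Ideal (LambdaStar K n) := Ideal.span (Set.range (FreeAlgebra.ι K))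

/-- The trivial `Λ*`-module `K = Λ* / I*`. -/
abbrev TrivialModule : Type u :=
  LambdaStar K n ⧸ (augIdeal K n : Submodule (LambdaStar K n) (LambdaStar K n))

/-- The functor `M ↦ 𝕃 ⊗_{Λ*} M`. -/
abbrev leavittFunctor : ModuleCat.{u} (LambdaStar K n) ⥤ ModuleCat.{u} (LeavittAlgebra K n) :=
  tensorFunctor (lambdaStarToLeavitt K n : LambdaStar K n →+* LeavittAlgebra K n)

end Leavitt

/-! ## The categories of modules -/

section Categories

/-- Left modules over the `K`-algebra `A` that are finite-dimensional over `K`. -/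
def isFiniteDim (K : Type u) [Field K] (A : Type u) [Ring A] [Algebra K A] :
    ObjectProperty (ModuleCat.{u} A) :=
  fun M => Module.Finite K M

/-- Finitely presented left modules of finite length. -/
def isFPL (A : Type u) [Ring A] : ObjectProperty (ModuleCat.{u} A) :=
  fun M => Module.FinitePresentation A M ∧ IsFiniteLength A M

variable (K : Type u) [Field K] (n : ℕ)

/-- Leavitt modules: finite-dimensional `Λ*`-modules `M` such that no simple subfactor `P / N`,
`N ≤ P ≤ M`, is isomorphic to the trivial module. -/
def isLeavitt : ObjectProperty (ModuleCat.{u} (LambdaStar K n)) :=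
  fun M => isFiniteDim K (LambdaStar K n) M ∧
    ∀ N P : Submodule (LambdaStar K n) M, N ≤ P →
      IsSimpleModule (LambdaStar K n) (P ⧸ N.submoduleOf P) →
        IsEmpty ((P ⧸ N.submoduleOf P) ≃ₗ[LambdaStar K n] TrivialModule K n)

/-- Leavitt-torsion modules, as a property of objects of the category of finite-dimensional
`Λ*`-modules: every simple subfactor `P / N`, `N ≤ P ≤ M`, is isomorphic to the trivial module. -/
def isLeavittTorsion : ObjectProperty (isFiniteDim K (LambdaStar K n)).FullSubcategory :=
  fun M => ∀ N P : Submodule (LambdaStar K n) M.obj, N ≤ P →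
    IsSimpleModule (LambdaStar K n) (P ⧸ N.submoduleOf P) →
      Nonempty ((P ⧸ N.submoduleOf P) ≃ₗ[LambdaStar K n] TrivialModule K n)

theorem isLeavitt_le : isLeavitt K n ≤ isFiniteDim K (LambdaStar K n) := fun _ h => h.1

end Categories

/-! ## Finite-dimensional modules form an abelian category -/

section Abelian

variable (K : Type u) [Field K] (A : Type u) [Ring A] [Algebra K A]

instance isFiniteDim_isSerreClass : (isFiniteDim K A).IsSerreClass where
  exists_zero := ⟨ModuleCat.of A PUnit, ModuleCat.isZero_of_subsingleton _,
    (inferInstance : Module.Finite K (ModuleCat.of A PUnit.{u + 1}))⟩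
  prop_of_mono {X Y} f _ hY := by
    have : Module.Finite K Y := hY
    exact Module.Finite.of_injective (f.hom.restrictScalars K)
      ((ModuleCat.mono_iff_injective f).1 inferInstance)
  prop_of_epi {X Y} f _ hX := by
    have : Module.Finite K X := hX
    exact Module.Finite.of_surjective (f.hom.restrictScalars K)
      ((ModuleCat.epi_iff_surjective f).1 inferInstance)
  prop_X₂_of_shortExact {S} hS h₁ h₃ := by
    have : Module.Finite K S.X₁ := h₁
    have : Module.Finite K S.X₃ := h₃
    have hex := (ShortComplex.ShortExact.moduleCat_exact_iff_function_exact S).1 hS.exact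
    exact Module.Finite.of_exact (f := S.f.hom.restrictScalars K) (g := S.g.hom.restrictScalars K) hex
      hS.moduleCat_surjective_g

instance isFiniteDim_isClosedUnderFiniteProducts :
    (isFiniteDim K A).IsClosedUnderFiniteProducts := by
  have : (isFiniteDim K A).IsClosedUnderBinaryProducts :=
    { limitsOfShape_le := by
        rintro X ⟨p⟩
        refine (isFiniteDim K A).prop_of_iso ?_ ((isFiniteDim K A).prop_biprod
          (p.prop_diag_obj (.mk .left)) (p.prop_diag_obj (.mk .right)))
        exact Limits.IsLimit.conePointUniqueUpToIso (Limits.BinaryBiproduct.isLimit _ _)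
          ((Limits.IsLimit.postcomposeHomEquiv (Limits.diagramIsoPair p.diag) _).2 p.isLimit) }
  exact .mk'

end Abelian

end

/-! Everything is governed by words in the `xᵢ*`. Call `m` saturated into `V` (`Sat`) if all
sufficiently long words map `m` into `V`. Since `y = ∑ xᵢ xᵢ* y`, an `𝕃`-submodule contains every
element saturated into it, and the elements saturated into a subspace stable under the `xᵢ*` form an
`𝕃`-submodule. Hence every element of `𝕃 ⊗ M` is saturated into the image of `M`
(`sat_range_tunit`). That `1 ⊗ m = 0` only if long words kill `m` (`sat_of_tunit_eq_zero`) needs a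
concrete `𝕃`-module: germs of `M`-valued functions on words (`GermModule`), to which `M` maps by `m
↦ (w ↦ w m)`. A module is Leavitt-torsion if and only if long words kill each of its elements
(`forall_subfactor_trivial_iff`), so the functor kills exactly the torsion modules.

An `𝕃`-linear `φ : 𝕃 ⊗ M → 𝕃 ⊗ M'` is a fraction: the graph of all `(m, m')` with `φ (1 ⊗ m) = 1 ⊗
m'` projects to `M` with torsion kernel and cokernel. If `M` and `M'` are Leavitt modules, this
projection is bijective and `φ` comes from a map `M → M'`. With a calculus of fractions
(`isLocalization_of_exists_rightFraction`), the localization statement is reduced to essential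
surjectivity.

For the latter, a finitely presented `N` of finite length must be generated by a finite-dimensional
subspace stable under the `xᵢ*` (`exists_finite_stable_subspace`). Only here does `n ≥ 2` enter: `𝕃
≅ 𝕃ⁿ` prevents `𝕃` from being noetherian, while an unstable presenting subspace would embed `𝕃` into
a quotient of `N`. For modules over `A`, an element of `I*` that acts as `1` excludes trivial
subfactors. -/

noncomputable section

/-! ## Saturation under a family of operators -/

section Sat

variable {ι : Type*} {M : Type*}

/-- `Sat T V m` says that all sufficiently long words in the operators `T i` map `m` into `V`. -/
inductive Sat (T : ι → M → M) (V : Set M) : M → Prop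
  | mem {m : M} : m ∈ V → Sat T V m
  | step {m : M} : (∀ i, Sat T V (T i m)) → Sat T V m

namespace Sat

variable {T : ι → M → M} {V W : Set M}

theorem apply (hV : ∀ i, ∀ m ∈ V, T i m ∈ V) {m : M} (h : Sat T V m) (i : ι) :
    Sat T V (T i m) := by
  cases h with
  | mem h => exact mem (hV i m h)
  | step h => exact h i

/-- The two summands may need words of different lengths. Stability of `V` keeps the one that has
already arrived inside `V`. -/
theorem add [AddCommGroup M] (hT : ∀ i a b, T i (a + b) = T i a + T i b)
    (hV : ∀ i, ∀ m ∈ V, T i m ∈ V) (hadd : ∀ a ∈ V, ∀ b ∈ V, a + b ∈ V) {a b : M}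
    (ha : Sat T V a) (hb : Sat T V b) : Sat T V (a + b) := by
  induction ha generalizing b with
  | mem ha =>
    rename_i a
    induction hb generalizing a with
    | mem hb => exact mem (hadd _ ha _ hb)
    | step _ ih =>
      refine step fun i => ?_
      rw [hT]
      exact ih i (hV i _ ha)
  | step _ ih =>
    refine step fun i => ?_
    rw [hT]
    exact ih i (hb.apply hV i)

/-- Saturation is transported by a map that intertwines the operators. -/
theorem map {N : Type*} {T' : ι → N → N} {V' : Set N} (f : M → N)
    (hf : ∀ i m, f (T i m) = T' i (f m)) (hV : ∀ m ∈ V, Sat T' V' (f m)) {m : M}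
    (h : Sat T V m) : Sat T' V' (f m) := by
  induction h with
  | mem h => exact hV _ h
  | step _ ih => exact step fun i => by rw [← hf]; exact ih i

theorem trans (hV : ∀ m ∈ V, Sat T W m) {m : M} (h : Sat T V m) : Sat T W m :=
  h.map (T' := T) id (fun _ _ => rfl) hV

theorem mono (hVW : V ⊆ W) {m : M} (h : Sat T V m) : Sat T W m :=
  h.trans fun _ hm => mem (hVW hm)

/-- Saturation is pulled back by a map that intertwines the operators. -/
theorem comap {N : Type*} {T' : ι → N → N} {V' : Set N} (f : M → N)
    (hf : ∀ i m, f (T i m) = T' i (f m)) (hV : ∀ m, f m ∈ V' → Sat T V m) {m : M}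
    (h : Sat T' V' (f m)) : Sat T V m := by
  generalize hy : f m = y at h
  induction h generalizing m with
  | mem h => exact hV m (hy ▸ h)
  | step _ ih => exact step fun i => ih i (by rw [hf, hy])

end Sat

end Sat

/-! ## The Leavitt algebra -/

section Leavitt

variable (K : Type u) [Field K] (n : ℕ)

/-- The generator `xᵢ` of the Leavitt algebra. -/
def leavittX (i : Fin n) : LeavittAlgebra K n := leavittProj K n (FreeAlgebra.ι K (Sum.inl i))

/-- The generator `xᵢ*` of the Leavitt algebra. -/
def leavittXs (i : Fin n) : LeavittAlgebra K n := leavittProj K n (FreeAlgebra.ι K (Sum.inr i))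

theorem sum_leavittX_mul_leavittXs : ∑ i, leavittX K n i * leavittXs K n i = 1 := by
  have h := RingQuot.mkAlgHom_rel K (LeavittRel.sum (K := K) (n := n))
  rw [map_sum, map_one] at h
  simp only [map_mul] at h
  exact h

theorem leavittXs_mul_leavittX (i j : Fin n) :
    leavittXs K n j * leavittX K n i = if j = i then 1 else 0 := by
  split_ifs with hij
  · subst hij
    have h := RingQuot.mkAlgHom_rel K (LeavittRel.same (K := K) (n := n) j)
    rw [map_mul, map_one] at h
    exact h
  · have h := RingQuot.mkAlgHom_rel K (LeavittRel.diff (K := K) (n := n) i j hij)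
    rw [map_mul, map_zero] at h
    exact h

@[simp]
theorem lambdaStarToLeavitt_ι (i : Fin n) :
    lambdaStarToLeavitt K n (FreeAlgebra.ι K i) = leavittXs K n i :=
  FreeAlgebra.lift_ι_apply _ _

variable {K n}

section Module

variable {N : Type*} [AddCommGroup N] [Module (LeavittAlgebra K n) N]

theorem sum_leavittX_smul_leavittXs_smul (y : N) :
    ∑ i, leavittX K n i • leavittXs K n i • y = y := by
  simp_rw [smul_smul]
  rw [← Finset.sum_smul, sum_leavittX_mul_leavittXs, one_smul]

theorem leavittXs_smul_leavittX_smul (i j : Fin n) (y : N) :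
    leavittXs K n j • leavittX K n i • y = if j = i then y else 0 := by
  rw [smul_smul, leavittXs_mul_leavittX]
  split_ifs <;> simp

theorem eq_zero_of_leavittXs_smul {y : N} (h : ∀ i, leavittXs K n i • y = 0) : y = 0 := by
  rw [← sum_leavittX_smul_leavittXs_smul (K := K) (n := n) y]
  simp [h]

/-- The action of `xᵢ*` on a module over the Leavitt algebra. -/
def xsAct (N : Type*) [AddCommGroup N] [Module (LeavittAlgebra K n) N] (i : Fin n) (y : N) : N :=
  leavittXs K n i • y

theorem mem_of_sat (S : Submodule (LeavittAlgebra K n) N) {E : Set N} (hE : E ⊆ S) {y : N}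
    (h : Sat (xsAct (K := K) (n := n) N) E y) : y ∈ S := by
  induction h with
  | mem h => exact hE h
  | @step y _ ih =>
    rw [← sum_leavittX_smul_leavittXs_smul (K := K) (n := n) y]
    exact sum_mem fun i _ => S.smul_mem _ (ih i)

/-- A subgroup that is stable under the generators is stable under the Leavitt algebra. -/
theorem leavitt_smul_mem (S : AddSubgroup N)
    (hK : ∀ (k : K), ∀ y ∈ S, algebraMap K (LeavittAlgebra K n) k • y ∈ S)
    (hx : ∀ i, ∀ y ∈ S, leavittX K n i • y ∈ S) (hxs : ∀ i, ∀ y ∈ S, leavittXs K n i • y ∈ S)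
    (s : LeavittAlgebra K n) : ∀ y ∈ S, s • y ∈ S := by
  obtain ⟨a, rfl⟩ := RingQuot.mkAlgHom_surjective K (LeavittRel K n) s
  change ∀ y ∈ S, leavittProj K n a • y ∈ S
  induction a using FreeAlgebra.induction with
  | grade0 k =>
    intro y hy
    rw [AlgHom.commutes]
    exact hK k y hy
  | grade1 i =>
    cases i with
    | inl i => exact hx i
    | inr i => exact hxs i
  | mul a b ha hb =>
    intro y hy
    rw [map_mul, mul_smul]
    exact ha _ (hb y hy)
  | add a b ha hb =>
    intro y hy
    rw [map_add, add_smul]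
    exact add_mem (ha y hy) (hb y hy)

variable [Module K N] [IsScalarTower K (LeavittAlgebra K n) N]

/-- The saturation of a subspace that is stable under all `xᵢ*`. -/
def satSubmodule (E : Submodule K N) (hE : ∀ i, ∀ y ∈ E, leavittXs K n i • y ∈ E) :
    Submodule (LeavittAlgebra K n) N :=
  have hadd : ∀ {a b : N}, Sat (xsAct (K := K) (n := n) N) E a →
      Sat (xsAct (K := K) (n := n) N) E b → Sat (xsAct (K := K) (n := n) N) E (a + b) :=
    Sat.add (fun _ _ _ => smul_add _ _ _) hE (fun _ ha _ hb => E.add_mem ha hb)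
  have hK : ∀ (k : K) (y : N), Sat (xsAct (K := K) (n := n) N) E y →
      Sat (xsAct (K := K) (n := n) N) E (algebraMap K (LeavittAlgebra K n) k • y) := by
    intro k y hy
    refine hy.map (fun y => algebraMap K (LeavittAlgebra K n) k • y) (fun i m => ?_)
      (fun m hm => Sat.mem ?_)
    · simp only [xsAct, smul_smul, Algebra.commutes]
    · simp only [algebraMap_smul]
      exact E.smul_mem k hm
  { carrier := {y | Sat (xsAct (K := K) (n := n) N) E y}
    add_mem' := hadd
    zero_mem' := Sat.mem E.zero_mem
    smul_mem' := fun s y hy => leavitt_smul_mem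
      { carrier := {y | Sat (xsAct (K := K) (n := n) N) E y}
        add_mem' := hadd
        zero_mem' := Sat.mem E.zero_mem
        neg_mem' := fun {y} hy => by
          have := hK (-1) y hy
          simpa using this } hK
      -- Applying `xᵢ` costs one more letter: `xⱼ* xᵢ y` is `y` or `0`.
      (fun i y hy => Sat.step fun j => by
        simp only [xsAct, leavittXs_smul_leavittX_smul]
        split_ifs
        · exact hy
        · exact Sat.mem E.zero_mem)
      (fun i y hy => hy.apply hE i) s y hy }

theorem sat_of_span_eq_top (E : Submodule K N) (hE : ∀ i, ∀ y ∈ E, leavittXs K n i • y ∈ E)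
    (hspan : Submodule.span (LeavittAlgebra K n) (E : Set N) = ⊤) (y : N) :
    Sat (xsAct (K := K) (n := n) N) E y := by
  have h : Submodule.span (LeavittAlgebra K n) (E : Set N) ≤ satSubmodule E hE :=
    Submodule.span_le.2 fun _ hy => Sat.mem hy
  exact h (hspan ▸ Submodule.mem_top)

end Module

/-! ## Germs of functions on words -/

section Germ

variable {M : Type u} [AddCommGroup M] [Module K M]

variable (K n M) in
/-- Functions on words that vanish on all sufficiently long words. -/
def eventuallyZero : Submodule K (List (Fin n) → M) where
  carrier := {f | ∃ k : ℕ, ∀ w : List (Fin n), k ≤ w.length → f w = 0}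
  add_mem' := by
    rintro f g ⟨k, hk⟩ ⟨l, hl⟩
    refine ⟨max k l, fun w hw => ?_⟩
    simp [hk w (le_trans (le_max_left _ _) hw), hl w (le_trans (le_max_right _ _) hw)]
  zero_mem' := ⟨0, fun _ _ => rfl⟩
  smul_mem' := by
    rintro c f ⟨k, hk⟩
    exact ⟨k, fun w hw => by simp [hk w hw]⟩

variable (K n M) in
/-- Germs of `M`-valued functions on words, for the filter of all long words. -/
abbrev GermSpace : Type u := (List (Fin n) → M) ⧸ eventuallyZero K n M

/-- Restriction of a function on words to the words that start with `i`. -/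
def germXs (i : Fin n) : Module.End K (GermSpace K n M) :=
  Submodule.mapQ _ _ (LinearMap.funLeft K M (List.cons i)) <| by
    rintro f ⟨k, hk⟩
    exact ⟨k, fun w hw => hk _ (hw.trans (by simp))⟩

/-- The function on words that is `f` on the words that start with `i`. -/
def extendCons (i : Fin n) : (List (Fin n) → M) →ₗ[K] (List (Fin n) → M) where
  toFun f w := match w with
    -- The value at the empty word is arbitrary, since it does not affect the germ.
    | [] => 0
    | j :: w => if j = i then f w else 0
  map_add' f g := by
    funext w
    rcases w with _ | ⟨j, w⟩
    · simp
    · by_cases h : j = i <;> simp [h]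
  map_smul' c f := by
    funext w
    rcases w with _ | ⟨j, w⟩
    · simp
    · by_cases h : j = i <;> simp [h]

/-- Extension by zero from the words that start with `i`. -/
def germX (i : Fin n) : Module.End K (GermSpace K n M) :=
  Submodule.mapQ _ _ (extendCons i) <| by
    rintro f ⟨k, hk⟩
    refine ⟨k + 1, fun w hw => ?_⟩
    rcases w with _ | ⟨j, w⟩
    · rfl
    · have := hk w (by simpa using hw)
      simp [extendCons, this]

theorem germXs_mul_germX (i j : Fin n) :
    germXs (K := K) (M := M) j * germX i = if j = i then 1 else 0 := by
  refine Submodule.linearMap_qext _ (LinearMap.ext fun f => ?_)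
  change (eventuallyZero K n M).mkQ (fun w => extendCons (K := K) i f (j :: w)) = _
  split_ifs with h
  · simp [extendCons, h]
  · simp [extendCons, h]
    exact zero_mem (eventuallyZero K n M)

theorem sum_germX_mul_germXs :
    ∑ i, germX (K := K) (n := n) (M := M) i * germXs i = 1 := by
  refine Submodule.linearMap_qext _ (LinearMap.ext fun f => ?_)
  have : (((∑ i, germX (K := K) (n := n) (M := M) i * germXs i) ∘ₗ (eventuallyZero K n M).mkQ) f) =
      (eventuallyZero K n M).mkQ (∑ i, extendCons (K := K) i (fun w => f (i :: w))) := by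
    rw [map_sum, LinearMap.comp_apply, LinearMap.sum_apply]
    rfl
  rw [this]
  -- The two functions can differ only at the empty word, hence the bound `1`. On functions rather
  -- than germs this relation would fail.
  refine (Submodule.Quotient.eq _).2 ⟨1, fun w hw => ?_⟩
  rcases w with _ | ⟨j, w⟩
  · simp at hw
  · simp [extendCons]

/-- The action of the Leavitt algebra on germs. -/
def germAction : LeavittAlgebra K n →ₐ[K] Module.End K (GermSpace K n M) :=
  RingQuot.liftAlgHom K ⟨FreeAlgebra.lift K (Sum.elim germX germXs), by
    rintro _ _ (_ | i | ⟨i, j, h⟩)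
    · simp [sum_germX_mul_germXs]
    · simp [germXs_mul_germX]
    · simp [germXs_mul_germX, h]⟩

/-- The module of germs attached to a family of operators `T` on `M`. -/
def GermModule (_T : Fin n → Module.End K M) : Type u := GermSpace K n M

variable (T : Fin n → Module.End K M)

instance : AddCommGroup (GermModule T) := inferInstanceAs (AddCommGroup (GermSpace K n M))
instance : Module K (GermModule T) := inferInstanceAs (Module K (GermSpace K n M))
instance : Module (LeavittAlgebra K n) (GermModule T) :=
  Module.compHom (GermSpace K n M) (germAction (K := K) (n := n) (M := M)).toRingHom

theorem GermModule.smul_def (s : LeavittAlgebra K n) (y : GermModule T) :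
    s • y = germAction (K := K) (n := n) (M := M) s y := rfl

instance : IsScalarTower K (LeavittAlgebra K n) (GermModule T) where
  smul_assoc k s y := by
    simp only [GermModule.smul_def, map_smul]
    rfl

/-- The function `w ↦ T_w m` on words. -/
def wordFun (m : M) : List (Fin n) → M
  | [] => m
  -- The head of the word acts first, so that restriction to words starting with `i` corresponds to
  -- `m ↦ T i m`.
  | i :: w => wordFun (T i m) w

/-- The linear map `m ↦ (w ↦ T_w m)`. -/
def wordMap : M →ₗ[K] (List (Fin n) → M) where
  toFun := wordFun T
  map_add' a b := by
    funext w
    induction w generalizing a b with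
    | nil => rfl
    | cons i w ih =>
      simp only [wordFun, map_add, Pi.add_apply] at ih ⊢
      exact ih _ _
  map_smul' c a := by
    funext w
    induction w generalizing a with
    | nil => rfl
    | cons i w ih =>
      simp only [wordFun, map_smul, Pi.smul_apply, RingHom.id_apply] at ih ⊢
      exact ih _

/-- The germ of the function `w ↦ T_w m`. -/
def toGerm : M →ₗ[K] GermModule T := (eventuallyZero K n M).mkQ ∘ₗ wordMap T

theorem leavittXs_smul_toGerm (i : Fin n) (m : M) :
    leavittXs K n i • toGerm T m = toGerm T (T i m) := by
  have : germAction (K := K) (M := M) (leavittXs K n i) = germXs i := by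
    refine (RingQuot.liftAlgHom_mkAlgHom_apply _ _ _ _).trans ?_
    simp
  rw [GermModule.smul_def, this]
  rfl

theorem sat_of_toGerm_eq_zero {m : M} (h : toGerm T m = 0) : Sat (fun i => T i) {0} m := by
  obtain ⟨k, hk⟩ := (Submodule.Quotient.mk_eq_zero _).1 h
  change ∀ w, k ≤ w.length → wordFun T m w = 0 at hk
  clear h
  induction k generalizing m with
  | zero => exact .mem (hk [] le_rfl)
  | succ k ih => exact .step fun i => ih fun w hw => hk (i :: w) (by simpa using hw)

end Germ

/-- Over the zero ring all germs would vanish, but the constant function `1` on words has a nonzero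
germ as soon as there are arbitrarily long words. -/
theorem leavitt_nontrivial (hn : 0 < n) : Nontrivial (LeavittAlgebra K n) := by
  by_contra hc
  rw [not_nontrivial_iff_subsingleton] at hc
  let T : Fin n → Module.End K K := fun _ => 1
  have h : toGerm T 1 = 0 := by
    rw [← one_smul (LeavittAlgebra K n) (toGerm T 1), Subsingleton.elim (1 : LeavittAlgebra K n) 0,
      zero_smul]
  have key : ∀ m : K, Sat (fun i => T i) {0} m → m = 0 := by
    intro m hm
    induction hm with
    | mem h => exact h
    | step _ ih => exact ih ⟨0, hn⟩
  exact one_ne_zero (key 1 (sat_of_toGerm_eq_zero T h))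

/-- As a left module, the Leavitt algebra is isomorphic to its `n`-th power. -/
def leavittEquivPi : LeavittAlgebra K n ≃ₗ[LeavittAlgebra K n] (Fin n → LeavittAlgebra K n) where
  toFun s i := s * leavittX K n i
  map_add' a b := by funext i; simp [add_mul]
  map_smul' a b := by funext i; simp [mul_assoc]
  invFun f := ∑ i, f i * leavittXs K n i
  left_inv s := by
    simp only [mul_assoc]
    rw [← Finset.mul_sum, sum_leavittX_mul_leavittXs, mul_one]
  right_inv f := by
    funext j
    simp [Finset.sum_mul, mul_assoc, leavittXs_mul_leavittX]

/-- A nontrivial noetherian ring has invariant basis number, which `𝕃 ≅ 𝕃ⁿ` contradicts. -/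
theorem leavitt_not_isNoetherianRing (hn : 2 ≤ n) : ¬ IsNoetherianRing (LeavittAlgebra K n) := by
  intro _
  have := leavitt_nontrivial (K := K) (n := n) (by omega)
  have := IsNoetherianRing.strongRankCondition (LeavittAlgebra K n)
  have e := (LinearEquiv.funUnique (Fin 1) (LeavittAlgebra K n) (LeavittAlgebra K n)).trans
    (leavittEquivPi (K := K) (n := n))
  have := eq_of_fin_equiv (LeavittAlgebra K n) e
  omega

end Leavitt

/-! ## The universal property of extension of scalars -/

section ExtendScalars

variable {R S : Type u} [Ring R] [Ring S] (φ : R →+* S)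
variable (M : Type u) [AddCommGroup M] [Module R M] {N : Type u} [AddCommGroup N] [Module S N]

/-- The canonical semilinear map `m ↦ 1 ⊗ m`. -/
def TensorOver.unit : M →ₛₗ[φ] TensorOver φ M where
  toFun m := TensorOver.tmul φ 1 m
  map_add' a b := by
    simp only [TensorOver.tmul, TensorProduct.tmul_add, map_add]
    rfl
  map_smul' r m := by
    symm
    refine (Submodule.Quotient.eq _).2 (Submodule.subset_span ⟨1, r, m, ?_⟩)
    simp [TensorProduct.smul_tmul']

variable {M}

theorem TensorOver.tmul_eq_smul_unit (s : S) (m : M) :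
    TensorOver.tmul φ s m = s • TensorOver.unit φ M m := by
  change (tensorRelations φ M).mkQ (s ⊗ₜ[ℤ] m) = s • (tensorRelations φ M).mkQ (1 ⊗ₜ[ℤ] m)
  rw [← map_smul, TensorProduct.smul_tmul', smul_eq_mul, mul_one]

theorem TensorOver.ext_unit {f g : TensorOver φ M →ₗ[S] N}
    (h : ∀ m, f (TensorOver.unit φ M m) = g (TensorOver.unit φ M m)) : f = g :=
  TensorOver.hom_ext φ fun s m => by
    rw [TensorOver.tmul_eq_smul_unit, map_smul, map_smul, h]

theorem TensorOver.span_range_unit :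
    Submodule.span S (Set.range (TensorOver.unit φ M)) = ⊤ := by
  have h : (Submodule.span S (Set.range (TensorOver.unit φ M))).mkQ = 0 :=
    TensorOver.ext_unit φ fun m =>
      (Submodule.Quotient.mk_eq_zero _).2 (Submodule.subset_span ⟨m, rfl⟩)
  simpa using congrArg LinearMap.ker h

/-- The linear map out of `S ⊗_R M` that is induced by a semilinear map out of `M`. -/
def TensorOver.lift (g : M →ₛₗ[φ] N) : TensorOver φ M →ₗ[S] N :=
  (tensorRelations φ M).liftQ
    (TensorProduct.AlgebraTensorModule.lift
      (LinearMap.toSpanSingleton S (M →ₗ[ℤ] N) g.toAddMonoidHom.toIntLinearMap)) <| by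
    refine Submodule.span_le.2 ?_
    rintro _ ⟨s, r, m, rfl⟩
    simp [mul_smul]

@[simp]
theorem TensorOver.lift_unit (g : M →ₛₗ[φ] N) (m : M) :
    TensorOver.lift φ g (TensorOver.unit φ M m) = g m := by
  change (TensorProduct.AlgebraTensorModule.lift
      (LinearMap.toSpanSingleton S (M →ₗ[ℤ] N) g.toAddMonoidHom.toIntLinearMap)) (1 ⊗ₜ[ℤ] m) = g m
  simp

instance (K : Type*) [CommRing K] [Algebra K S] : Module K (TensorOver φ M) :=
  Module.restrictScalars K S (TensorOver φ M)

instance (K : Type*) [CommRing K] [Algebra K S] : IsScalarTower K S (TensorOver φ M) :=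
  IsScalarTower.restrictScalars K S (TensorOver φ M)

end ExtendScalars

/-! ## Extension of scalars to the Leavitt algebra -/

section LeavittTensor

variable {K : Type u} [Field K] {n : ℕ}
variable {M : Type u} [AddCommGroup M] [Module (LambdaStar K n) M]

variable (K n) in
/-- The canonical ring homomorphism to the Leavitt algebra. -/
abbrev toLeavitt : LambdaStar K n →+* LeavittAlgebra K n :=
  (lambdaStarToLeavitt K n : LambdaStar K n →+* LeavittAlgebra K n)

@[simp]
theorem toLeavitt_ι (i : Fin n) : toLeavitt K n (FreeAlgebra.ι K i) = leavittXs K n i :=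
  lambdaStarToLeavitt_ι K n i

@[simp]
theorem toLeavitt_algebraMap (k : K) :
    toLeavitt K n (algebraMap K _ k) = algebraMap K _ k :=
  AlgHom.commutes _ _

/-- The action of `xᵢ*` on a module over the free algebra. -/
def iotaAct (M : Type u) [AddCommGroup M] [Module (LambdaStar K n) M] (i : Fin n) (m : M) : M :=
  FreeAlgebra.ι K i • m

theorem lambdaStar_smul_mem (S : AddSubgroup M)
    (hK : ∀ (k : K), ∀ y ∈ S, algebraMap K (LambdaStar K n) k • y ∈ S)
    (hx : ∀ i, ∀ y ∈ S, (FreeAlgebra.ι K i : LambdaStar K n) • y ∈ S)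
    (r : LambdaStar K n) : ∀ y ∈ S, r • y ∈ S := by
  induction r using FreeAlgebra.induction with
  | grade0 k => exact hK k
  | grade1 i => exact hx i
  | mul a b ha hb =>
    intro y hy
    rw [mul_smul]
    exact ha _ (hb y hy)
  | add a b ha hb =>
    intro y hy
    rw [add_smul]
    exact add_mem (ha y hy) (hb y hy)

/-- A `K`-linear map that is compatible with the generators is semilinear. -/
def semilinearOfGenerators {N : Type u} [AddCommGroup N] [Module (LeavittAlgebra K n) N]
    (g : M →+ N)
    (hK : ∀ (k : K) m, g (algebraMap K (LambdaStar K n) k • m) =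
      algebraMap K (LeavittAlgebra K n) k • g m)
    (hg : ∀ i m, g ((FreeAlgebra.ι K i : LambdaStar K n) • m) = leavittXs K n i • g m) :
    M →ₛₗ[toLeavitt K n] N where
  toFun := g
  map_add' := map_add g
  map_smul' r := by
    induction r using FreeAlgebra.induction with
    | grade0 k => simpa using hK k
    | grade1 i => simpa using hg i
    | mul a b ha hb =>
      intro y
      rw [mul_smul, ha, hb, map_mul, mul_smul]
    | add a b ha hb =>
      intro y
      rw [add_smul, map_add, ha, hb, map_add, add_smul]

variable (K n M) in
/-- The canonical map `M → 𝕃 ⊗ M`. -/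
abbrev tunit : M →ₛₗ[toLeavitt K n] TensorOver (toLeavitt K n) M :=
  TensorOver.unit (toLeavitt K n) M

theorem semilinear_iota {N : Type u} [AddCommGroup N] [Module (LeavittAlgebra K n) N]
    (g : M →ₛₗ[toLeavitt K n] N) (i : Fin n) (m : M) :
    g (iotaAct (K := K) (n := n) M i m) = xsAct (K := K) (n := n) N i (g m) := by
  rw [iotaAct, map_smulₛₗ, toLeavitt_ι]
  rfl

/-- The image of `M` is stable under the `xᵢ*` and generates `𝕃 ⊗ M`, so its saturation is
everything. This replaces explicit normal forms for tensors. -/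
theorem sat_range_tunit (y : TensorOver (toLeavitt K n) M) :
    Sat (xsAct (K := K) (n := n) _) (Set.range (tunit K n M)) y := by
  let E : Submodule K (TensorOver (toLeavitt K n) M) :=
    { carrier := Set.range (tunit K n M)
      add_mem' := by
        rintro _ _ ⟨a, rfl⟩ ⟨b, rfl⟩
        exact ⟨a + b, map_add _ _ _⟩
      zero_mem' := ⟨0, map_zero _⟩
      smul_mem' := by
        rintro k _ ⟨a, rfl⟩
        refine ⟨algebraMap K (LambdaStar K n) k • a, ?_⟩
        rw [map_smulₛₗ, toLeavitt_algebraMap, algebraMap_smul] }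
  refine sat_of_span_eq_top E ?_ (TensorOver.span_range_unit _) y
  rintro i _ ⟨m, rfl⟩
  exact ⟨iotaAct (K := K) (n := n) M i m, semilinear_iota _ i m⟩

theorem tunit_eq_zero_of_sat {m : M} (h : Sat (iotaAct (K := K) (n := n) M) {0} m) :
    tunit K n M m = 0 := by
  have h' := h.map (T' := xsAct (K := K) (n := n) (TensorOver (toLeavitt K n) M))
    (V' := {0}) (tunit K n M) (semilinear_iota _) (by rintro _ rfl; exact .mem (map_zero _))
  simpa using mem_of_sat (⊥ : Submodule (LeavittAlgebra K n) _) (by simp) h'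

/-- The map from `M` to germs factors through `𝕃 ⊗ M`, and a function on words with zero germ
vanishes on all long words. -/
theorem sat_of_tunit_eq_zero {m : M} (h : tunit K n M m = 0) :
    Sat (iotaAct (K := K) (n := n) M) {0} m := by
  let _ := Module.restrictScalars K (LambdaStar K n) M
  have := IsScalarTower.restrictScalars K (LambdaStar K n) M
  let T : Fin n → Module.End K M := fun i => Algebra.lsmul K K M (FreeAlgebra.ι K i)
  let g : M →ₛₗ[toLeavitt K n] GermModule T :=
    semilinearOfGenerators (toGerm T).toAddMonoidHom
      (fun k m => by simp [algebraMap_smul])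
      (fun i m => (leavittXs_smul_toGerm T i m).symm)
  refine sat_of_toGerm_eq_zero T (m := m) ?_
  have := TensorOver.lift_unit (toLeavitt K n) g m
  rw [h, map_zero] at this
  exact this.symm

/-- A linear map out of `𝕃 ⊗ M` is injective if it is so on the image of `M`. -/
theorem injective_of_tunit {N : Type u} [AddCommGroup N] [Module (LeavittAlgebra K n) N]
    (h : TensorOver (toLeavitt K n) M →ₗ[LeavittAlgebra K n] N)
    (hh : ∀ m, h (tunit K n M m) = 0 → tunit K n M m = 0) : Function.Injective h := by
  refine (injective_iff_map_eq_zero h).2 fun y hy => ?_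
  induction sat_range_tunit y with
  | mem hm =>
    obtain ⟨m, rfl⟩ := hm
    exact hh m hy
  | step _ ih => exact eq_zero_of_leavittXs_smul fun i => ih i (by rw [xsAct, map_smul, hy, smul_zero])

section FiniteDimensional

variable [Module K M] [IsScalarTower K (LambdaStar K n) M]

/-- The subspace of all `m` such that `1 ⊗ m` lies in a given submodule. -/
def comapTunit (P : Submodule (LeavittAlgebra K n) (TensorOver (toLeavitt K n) M)) :
    Submodule K M where
  carrier := {m | tunit K n M m ∈ P}
  add_mem' ha hb := by
    simp only [Set.mem_ofPred_eq, map_add] at *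
    exact P.add_mem ha hb
  zero_mem' := by simp
  smul_mem' k m hm := by
    simp only [Set.mem_ofPred_eq] at *
    rw [← algebraMap_smul (LambdaStar K n) k m, map_smulₛₗ]
    exact P.smul_mem _ hm

/-- Submodules of `𝕃 ⊗ M` are determined by their traces on `M`, because long words move every
element into the image of `M`. Chains are therefore bounded by the dimension of `M`. -/
theorem comapTunit_le_iff
    {P Q : Submodule (LeavittAlgebra K n) (TensorOver (toLeavitt K n) M)} :
    comapTunit P ≤ comapTunit Q ↔ P ≤ Q := by
  refine ⟨fun h y hy => ?_, fun h m hm => h hm⟩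
  refine mem_of_sat (K := K) (n := n) Q (E := Q) subset_rfl ?_
  induction sat_range_tunit y with
  | mem hm =>
    obtain ⟨m, rfl⟩ := hm
    exact .mem (h hy)
  | step _ ih => exact .step fun i => ih i (P.smul_mem _ hy)

variable [Module.Finite K M]

theorem isFiniteLength_tensor :
    IsFiniteLength (LeavittAlgebra K n) (TensorOver (toLeavitt K n) M) := by
  let f : Submodule (LeavittAlgebra K n) (TensorOver (toLeavitt K n) M) ↪o Submodule K M :=
    OrderEmbedding.ofMapLEIff comapTunit fun _ _ => comapTunit_le_iff
  refine isFiniteLength_iff_isNoetherian_isArtinian.2 ⟨?_, ?_⟩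
  · rw [isNoetherian_iff']
    exact f.strictMono.wellFoundedGT
  · rw [isArtinian_iff]
    exact (f.strictMono.wellFoundedLT).wf

theorem finitePresentation_tensor :
    Module.FinitePresentation (LeavittAlgebra K n) (TensorOver (toLeavitt K n) M) := by
  classical
  let b := Module.finBasis K M
  let d := Module.finrank K M
  let p : (Fin d → LeavittAlgebra K n) →ₗ[LeavittAlgebra K n] TensorOver (toLeavitt K n) M :=
    Fintype.linearCombination (LeavittAlgebra K n) (fun j => tunit K n M (b j))
  have hp : ∀ j, p (Pi.single j 1) = tunit K n M (b j) := fun j => by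
    simp [p, Fintype.linearCombination_apply_single]
  have htK : ∀ (k : K) (m : M), tunit K n M (k • m) = k • tunit K n M m := fun k m => by
    rw [← algebraMap_smul (LambdaStar K n) k m, map_smulₛₗ, toLeavitt_algebraMap, algebraMap_smul]
  have htsum : ∀ m, tunit K n M m = ∑ k, b.repr m k • tunit K n M (b k) := fun m => by
    conv_lhs => rw [← b.sum_repr m, map_sum]
    simp only [htK]
  -- The relations are the matrix entries of the action of the `xᵢ*` on the basis `b`. The inverse
  -- of the presentation map is induced by `g₀`, which sends each basis vector to the class of its
  -- generator.
  let rel : Fin n × Fin d → (Fin d → LeavittAlgebra K n) := fun q =>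
    leavittXs K n q.1 • (Pi.single q.2 1 : Fin d → LeavittAlgebra K n) -
      ∑ k, b.repr ((FreeAlgebra.ι K q.1 : LambdaStar K n) • b q.2) k • (Pi.single k 1 : Fin d → LeavittAlgebra K n)
  let R : Submodule (LeavittAlgebra K n) (Fin d → LeavittAlgebra K n) :=
    Submodule.span _ (Set.range rel)
  have hpK : ∀ (k : K) x, p (k • x) = k • p x := fun k x => by
    rw [← algebraMap_smul (LeavittAlgebra K n) k x, map_smul, algebraMap_smul]
  have hR : R ≤ LinearMap.ker p := by
    refine Submodule.span_le.2 ?_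
    rintro _ ⟨⟨i, j⟩, rfl⟩
    simp only [SetLike.mem_coe, LinearMap.mem_ker, rel, map_sub, map_smul, map_sum, hp, hpK]
    rw [← htsum, map_smulₛₗ, toLeavitt_ι, sub_self]
  let g₀ : M →ₗ[K] ((Fin d → LeavittAlgebra K n) ⧸ R) :=
    b.constr K fun j => R.mkQ (Pi.single j 1)
  have hg₀ : ∀ i m, g₀ ((FreeAlgebra.ι K i : LambdaStar K n) • m) = leavittXs K n i • g₀ m := by
    intro i
    have : g₀ ∘ₗ Algebra.lsmul K K M (FreeAlgebra.ι K i : LambdaStar K n) =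
        Algebra.lsmul K K _ (leavittXs K n i) ∘ₗ g₀ := by
      refine b.ext fun j => ?_
      have h : R.mkQ (rel (i, j)) = 0 :=
        (Submodule.Quotient.mk_eq_zero _).2 (Submodule.subset_span ⟨(i, j), rfl⟩)
      simp only [rel, map_sub, map_smul, map_sum, sub_eq_zero] at h
      simp only [LinearMap.comp_apply, Algebra.lsmul_coe]
      rw [show g₀ (b j) = R.mkQ (Pi.single j 1) by simp [g₀], h]
      conv_lhs => rw [← b.sum_repr (_ • b j), map_sum]
      refine Finset.sum_congr rfl fun k _ => ?_
      rw [map_smul, show g₀ (b k) = R.mkQ (Pi.single k 1) by simp [g₀]]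
      rfl
    exact fun m => LinearMap.congr_fun this m
  let g : M →ₛₗ[toLeavitt K n] ((Fin d → LeavittAlgebra K n) ⧸ R) :=
    semilinearOfGenerators g₀.toAddMonoidHom
      (fun k m => by simp [algebraMap_smul]) hg₀
  have hcomp : TensorOver.lift _ g ∘ₗ p = R.mkQ := by
    refine LinearMap.pi_ext' fun j => LinearMap.ext_ring ?_
    simp only [LinearMap.comp_apply, LinearMap.single_apply, hp]
    rw [TensorOver.lift_unit]
    change g₀ (b j) = _
    simp [g₀]
  refine Module.finitePresentation_of_surjective p ?_ ?_
  · rw [← LinearMap.range_eq_top, eq_top_iff, ← TensorOver.span_range_unit, Submodule.span_le]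
    rintro _ ⟨m, rfl⟩
    rw [htsum]
    refine sum_mem fun k _ => ?_
    exact ⟨b.repr m k • Pi.single k 1, by rw [hpK, hp]⟩
  · have : LinearMap.ker p = R := by
      refine le_antisymm (fun x hx => ?_) hR
      rw [← R.ker_mkQ, ← hcomp, LinearMap.mem_ker, LinearMap.comp_apply, LinearMap.mem_ker.1 hx,
        map_zero]
    rw [this]
    exact Submodule.fg_span (Set.finite_range rel)

end FiniteDimensional

end LeavittTensor

/-! ## Finitely presented modules of finite length over the Leavitt algebra -/

section FiniteStable

variable {K : Type u} [Field K] {n : ℕ}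

section Filtration

variable {N : Type u} [AddCommGroup N] [Module (LeavittAlgebra K n) N]
/-- Membership of a saturated element in submodules is tested by finitely many elements of the
subspace. -/
theorem exists_finite_test {E : Set N} {r : N} (h : Sat (xsAct (K := K) (n := n) N) E r) :
    ∃ S : Set N, S.Finite ∧ S ⊆ E ∧
      ∀ R : Submodule (LeavittAlgebra K n) N, r ∈ R ↔ S ⊆ R := by
  induction h with
  | @mem m h => exact ⟨{m}, Set.finite_singleton _, by simpa using h, fun R => by simp⟩
  | @step m _ ih =>
    choose S hS hSE hSR using ih
    refine ⟨⋃ i, S i, Set.finite_iUnion hS, Set.iUnion_subset hSE, fun R => ?_⟩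
    rw [Set.iUnion_subset_iff]
    simp only [← hSR]
    refine ⟨fun h i => R.smul_mem _ h, fun h => ?_⟩
    rw [← sum_leavittX_smul_leavittXs_smul (K := K) (n := n) m]
    exact sum_mem fun i _ => R.smul_mem _ (h i)

variable [Module K N] [IsScalarTower K (LeavittAlgebra K n) N]

/-- The action of `xᵢ*` as a `K`-linear map. -/
def xsEnd (N : Type u) [AddCommGroup N] [Module (LeavittAlgebra K n) N]
    [Module K N] [IsScalarTower K (LeavittAlgebra K n) N] (i : Fin n) : Module.End K N :=
  Algebra.lsmul K K N (leavittXs K n i)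

@[simp]
theorem xsEnd_apply (i : Fin n) (y : N) : xsEnd (K := K) N i y = leavittXs K n i • y := rfl

variable (n) in
/-- The subspace spanned by all `w y` with `y ∈ W` and `w` a word in the `xᵢ*` of length at most
`l`. -/
def wordSpan (W : Submodule K N) : ℕ → Submodule K N
  | 0 => W
  | l + 1 => wordSpan W l ⊔ ⨆ i : Fin n, (wordSpan W l).map (xsEnd N i)

theorem wordSpan_mono (W : Submodule K N) : Monotone (wordSpan n W) :=
  monotone_nat_of_le_succ fun _ => le_sup_left

theorem xs_smul_mem_wordSpan (W : Submodule K N) (l : ℕ) (i : Fin n) {y : N}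
    (hy : y ∈ wordSpan n W l) : leavittXs K n i • y ∈ wordSpan n W (l + 1) :=
  (le_iSup (fun i : Fin n => (wordSpan n W l).map (xsEnd N i)) i).trans le_sup_right
    (Submodule.mem_map_of_mem (f := xsEnd N i) hy)

theorem finite_wordSpan (W : Submodule K N) [hW : Module.Finite K W] (l : ℕ) :
    Module.Finite K (wordSpan n W l) := by
  induction l with
  | zero => exact hW
  | succ l ih =>
    rw [wordSpan]
    infer_instance

theorem mem_iSup_wordSpan (W : Submodule K N) {y : N} :
    y ∈ ⨆ l, wordSpan n W l ↔ ∃ l, y ∈ wordSpan n W l :=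
  Submodule.mem_iSup_of_directed _ (wordSpan_mono W).directed_le

theorem exists_subset_wordSpan (W : Submodule K N) {S : Set N} (hS : S.Finite)
    (h : S ⊆ ((⨆ l, wordSpan n W l : Submodule K N) : Set N)) : ∃ k, S ⊆ wordSpan n W k := by
  induction S, hS using Set.Finite.induction_on with
  | empty => exact ⟨0, by simp⟩
  | @insert a S _ _ ih =>
    obtain ⟨k, hk⟩ := ih ((Set.subset_insert _ _).trans h)
    obtain ⟨l, hl⟩ := (mem_iSup_wordSpan W).1 (h (Set.mem_insert _ _))
    refine ⟨max k l, Set.insert_subset (wordSpan_mono W (le_max_right _ _) hl)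
      (hk.trans (wordSpan_mono W (le_max_left _ _)))⟩

end Filtration

variable (N : Type u) [AddCommGroup N] [Module (LeavittAlgebra K n) N]
variable [Module K N] [IsScalarTower K (LeavittAlgebra K n) N]

/-- A finitely presented module is presented by the relations of the form `xᵢ* v = w` in a
finite-dimensional subspace. -/
theorem exists_presenting_subspace [Module.FinitePresentation (LeavittAlgebra K n) N] :
    ∃ V : Submodule K N, Module.Finite K V ∧
      Submodule.span (LeavittAlgebra K n) (V : Set N) = ⊤ ∧
      ∀ (N' : Type u) [AddCommGroup N'] [Module (LeavittAlgebra K n) N'] [Module K N']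
        [IsScalarTower K (LeavittAlgebra K n) N'] (g : N →ₗ[K] N'),
        (∀ i, ∀ v ∈ V, leavittXs K n i • v ∈ V →
          g (leavittXs K n i • v) = leavittXs K n i • g v) →
        ∃ h : N →ₗ[LeavittAlgebra K n] N', ∀ v ∈ V, h v = g v := by
  classical
  obtain ⟨d, R, e, t, ht⟩ := Module.FinitePresentation.exists_fin (LeavittAlgebra K n) N
  let q : (Fin d → LeavittAlgebra K n) →ₗ[LeavittAlgebra K n] N := e.symm.toLinearMap ∘ₗ R.mkQ
  have hq : Function.Surjective q := e.symm.surjective.comp R.mkQ_surjective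
  have hker : LinearMap.ker q = R := by
    rw [LinearEquiv.ker_comp, R.ker_mkQ]
  let W : Submodule K (Fin d → LeavittAlgebra K n) :=
    Submodule.span K (Set.range fun j => Pi.single j 1)
  have hW : Module.Finite K W := Module.Finite.span_of_finite K (Set.finite_range _)
  have hWtop : Submodule.span (LeavittAlgebra K n) (W : Set (Fin d → LeavittAlgebra K n)) = ⊤ := by
    refine top_unique ?_
    rw [← (Pi.basisFun (LeavittAlgebra K n) (Fin d)).span_eq]
    refine Submodule.span_mono ?_
    rintro _ ⟨j, rfl⟩
    exact Submodule.subset_span ⟨j, by simp⟩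
  have hsat : ∀ r, Sat (xsAct (K := K) (n := n) _)
      ((⨆ l, wordSpan n W l : Submodule K _) : Set (Fin d → LeavittAlgebra K n)) r := by
    refine sat_of_span_eq_top _ (fun i y hy => ?_) (top_unique ?_)
    · obtain ⟨l, hl⟩ := (mem_iSup_wordSpan W).1 hy
      exact (mem_iSup_wordSpan W).2 ⟨l + 1, xs_smul_mem_wordSpan W l i hl⟩
    · rw [← hWtop]
      exact Submodule.span_mono (le_iSup (wordSpan n W) 0)
  choose S hS hSE hSR using fun r => exists_finite_test (hsat r)
  -- One length `k` accommodates the finite tests of all the finitely many relations in `t`. The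
  -- subspace sought is the image in `N` of `wordSpan n W k`.
  obtain ⟨k, hk⟩ := exists_subset_wordSpan W (S := ⋃ r ∈ t, S r)
    (t.finite_toSet.biUnion fun r _ => hS r) (Set.iUnion₂_subset fun r _ => hSE r)
  have := finite_wordSpan (n := n) W k
  refine ⟨(wordSpan n W k).map (q.restrictScalars K), inferInstance, ?_, ?_⟩
  · have h := congrArg (Submodule.map q) hWtop
    rw [Submodule.map_span, Submodule.map_top, LinearMap.range_eq_top.2 hq] at h
    refine top_unique ?_
    rw [← h]
    refine Submodule.span_mono ?_
    rintro _ ⟨y, hy, rfl⟩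
    exact ⟨y, wordSpan_mono W (Nat.zero_le k) hy, rfl⟩
  · intro N' _ _ _ _ g hg
    let h' : (Fin d → LeavittAlgebra K n) →ₗ[LeavittAlgebra K n] N' :=
      Fintype.linearCombination (LeavittAlgebra K n) (fun j => g (q (Pi.single j 1)))
    -- Up to length `k`, both `q y` and `xᵢ* q y` stay in the chosen subspace, so the hypothesis on
    -- `g` carries the equality from one length to the next.
    have claim : ∀ l ≤ k, ∀ y ∈ wordSpan n W l, h' y = g (q y) := by
      intro l
      induction l with
      | zero =>
        intro _
        change W ≤ LinearMap.eqLocus (h'.restrictScalars K) (g ∘ₗ q.restrictScalars K)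
        refine Submodule.span_le.2 ?_
        rintro _ ⟨j, rfl⟩
        simp [h', Fintype.linearCombination_apply_single]
      | succ l ih =>
        intro hl
        have ih := ih (by omega)
        change wordSpan n W l ⊔ ⨆ i : Fin n, (wordSpan n W l).map (xsEnd _ i) ≤
          LinearMap.eqLocus (h'.restrictScalars K) (g ∘ₗ q.restrictScalars K)
        refine sup_le ih (iSup_le fun i => ?_)
        rintro _ ⟨y, hy, rfl⟩
        change h' (leavittXs K n i • y) = g (q (leavittXs K n i • y))
        rw [map_smul, map_smul, ih y hy, hg i]
        · exact ⟨y, wordSpan_mono W (by omega) hy, rfl⟩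
        · rw [← map_smul]
          exact ⟨_, wordSpan_mono W hl (xs_smul_mem_wordSpan W l i hy), rfl⟩
    have hRle : R ≤ LinearMap.ker h' := by
      rw [← ht, Submodule.span_le]
      intro r hr
      -- It suffices that `h'` kills the tests of `r`. These lie in `R` and in `wordSpan n W k`,
      -- where `h'` is `g ∘ q`.
      refine (hSR r _).2 fun y hy => ?_
      have hrR : r ∈ R := ht ▸ Submodule.subset_span hr
      have hyR : y ∈ R := (hSR r R).1 hrR hy
      have hyk : y ∈ wordSpan n W k := hk (Set.mem_biUnion hr hy)
      change h' y = 0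
      rw [claim k le_rfl y hyk]
      rw [← hker] at hyR
      rw [LinearMap.mem_ker.1 hyR, map_zero]
    refine ⟨R.liftQ h' hRle ∘ₗ e.toLinearMap, ?_⟩
    rintro _ ⟨y, hy, rfl⟩
    refine Eq.trans ?_ (claim k le_rfl y hy)
    simp [q]

/-- A presenting subspace of a noetherian module is stable under all `xᵢ*`: otherwise the Leavitt
algebra would embed into a quotient of the module. -/
theorem exists_finite_stable_subspace (hn : 2 ≤ n)
    [Module.FinitePresentation (LeavittAlgebra K n) N] [IsNoetherian (LeavittAlgebra K n) N] :
    ∃ V : Submodule K N, Module.Finite K V ∧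
      Submodule.span (LeavittAlgebra K n) (V : Set N) = ⊤ ∧
      ∀ i, ∀ v ∈ V, leavittXs K n i • v ∈ V := by
  classical
  obtain ⟨V, hfin, hspan, hext⟩ := exists_presenting_subspace (K := K) (n := n) N
  refine ⟨V, hfin, hspan, ?_⟩
  by_contra! hcon
  obtain ⟨i₀, v₁, hv₁, hv₁'⟩ := hcon
  -- `ℓ` vanishes on the vectors of `V` that `x_{i₀}*` keeps in `V`, but not at `v₁`. No presenting
  -- relation constrains it.
  obtain ⟨ℓ, hℓ, hℓV⟩ := Submodule.exists_le_ker_of_notMem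
    (p := V ⊓ V.comap (xsEnd N i₀)) (v := v₁) (fun h => hv₁' h.2)
  obtain ⟨π, hπ⟩ := LinearMap.exists_extend (LinearMap.id : V →ₗ[K] V)
  have hπV : ∀ v ∈ V, (π v : N) = v := fun v hv =>
    congrArg Subtype.val (LinearMap.congr_fun hπ ⟨v, hv⟩)
  -- On `N` the operator is `xⱼ*` forced back into `V` by `π`; for `j = i₀` it also deposits `ℓ v`
  -- in the second factor. On `0 × 𝕃` it is left multiplication by `xⱼ*`.
  let T : Fin n → Module.End K (N × LeavittAlgebra K n) := fun j =>
    LinearMap.prod (V.subtype ∘ₗ π ∘ₗ xsEnd N j ∘ₗ LinearMap.fst K _ _)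
      (xsEnd _ j ∘ₗ LinearMap.snd K _ _ +
        if j = i₀ then (LinearMap.toSpanSingleton K _ 1) ∘ₗ ℓ ∘ₗ LinearMap.fst K _ _ else 0)
  have hT : ∀ j v s, T j (v, s) = ((π (leavittXs K n j • v) : N),
      leavittXs K n j * s + if j = i₀ then ℓ v • 1 else 0) := by
    intro j v s
    by_cases h : j = i₀ <;> simp [T, h]
  have hT0 : ∀ j s, T j (0, s) = (0, leavittXs K n j * s) := by
    intro j s
    simp [hT]
  -- If `v` and `xⱼ* v` lie in `V`, then `π` changes nothing and the deposit vanishes, so `v ↦ (v,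
  -- 0)` respects the presentation.
  obtain ⟨h, hh⟩ := hext (GermModule T) (toGerm T ∘ₗ LinearMap.inl K _ _) <| by
    intro j v hv hjv
    change toGerm T (leavittXs K n j • v, 0) = leavittXs K n j • toGerm T (v, 0)
    rw [leavittXs_smul_toGerm, hT, hπV _ hjv, mul_zero, zero_add]
    split_ifs with hj
    · subst hj
      rw [show ℓ v = 0 from hℓV ⟨hv, hjv⟩, zero_smul]
    · rfl
  -- Acting by `x_{i₀}*` on `h v₁` gives the germ of `(π (x_{i₀}* v₁), ℓ v₁)`. Subtracting `h` of
  -- the first entry leaves the invertible scalar `ℓ v₁`.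
  have hmem : toGerm T (0, 1) ∈ LinearMap.range h := by
    have h1 : toGerm T (0, ℓ v₁ • 1) =
        leavittXs K n i₀ • h v₁ - h (π (leavittXs K n i₀ • v₁)) := by
      rw [hh _ hv₁, hh _ (π _).2]
      change _ = leavittXs K n i₀ • toGerm T (v₁, 0) - toGerm T (_, 0)
      rw [leavittXs_smul_toGerm, hT, ← map_sub]
      simp
    have h2 : toGerm T (0, 1) = algebraMap K (LeavittAlgebra K n) (ℓ v₁)⁻¹ •
        toGerm T (0, ℓ v₁ • 1) := by
      rw [algebraMap_smul, ← map_smul, Prod.smul_mk, smul_smul, inv_mul_cancel₀ hℓ]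
      simp
    rw [h2, h1, ← map_smul, ← map_sub]
    exact Submodule.smul_mem _ _ ⟨_, rfl⟩
  -- Injectivity of `s ↦ s • toGerm T (0, 1)` need only be checked on `E`, as `E` contains `1` and
  -- is stable under the `xⱼ*`, so that all of `𝕃` is saturated into it.
  let E : Submodule K (LeavittAlgebra K n) := LinearMap.eqLocus
    ((LinearMap.toSpanSingleton (LeavittAlgebra K n) _ (toGerm T (0, 1))).restrictScalars K)
    (toGerm T ∘ₗ LinearMap.inr K _ _)
  have hE : ∀ s, s ∈ E ↔ s • toGerm T (0, 1) = toGerm T (0, s) := fun s => Iff.rfl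
  have hsat : ∀ s, Sat (xsAct (K := K) (n := n) (LeavittAlgebra K n)) E s := by
    refine sat_of_span_eq_top E (fun j s hs => ?_) ?_
    · rw [hE] at hs ⊢
      rw [smul_assoc, hs, leavittXs_smul_toGerm, hT0]
      rfl
    · refine (Ideal.eq_top_iff_one _).2 (Submodule.subset_span ((hE 1).2 ?_))
      rw [one_smul]
  -- In `𝕃` there is no torsion: `s = 0` once all `xⱼ* s` vanish.
  have hzero : ∀ x : N × LeavittAlgebra K n, Sat (fun j => T j) {0} x → x.1 = 0 → x.2 = 0 := by
    intro x hx
    induction hx with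
    | mem hx => exact fun _ => congrArg Prod.snd hx
    | @step x _ ih =>
      obtain ⟨v, s⟩ := x
      rintro rfl
      refine eq_zero_of_leavittXs_smul (K := K) (n := n) fun j => ?_
      have := ih j (by rw [hT0])
      rwa [hT0] at this
  have hinj : Function.Injective
      (LinearMap.toSpanSingleton (LeavittAlgebra K n) _ (toGerm T (0, 1))) := by
    refine (injective_iff_map_eq_zero _).2 fun s hs => ?_
    rw [LinearMap.toSpanSingleton_apply] at hs
    induction hsat s with
    | mem hm =>
      rw [SetLike.mem_coe, hE] at hm
      exact hzero (0, _) (sat_of_toGerm_eq_zero T (hm.symm.trans hs)) rfl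
    | step _ ih =>
      refine eq_zero_of_leavittXs_smul fun j => ih j ?_
      rw [xsAct, smul_assoc, hs, smul_zero]
  refine leavitt_not_isNoetherianRing (K := K) hn ?_
  have : IsNoetherian (LeavittAlgebra K n) (LinearMap.range h) :=
    isNoetherian_of_surjective h.rangeRestrict (LinearMap.range_eq_top.2 h.surjective_rangeRestrict)
  refine isNoetherian_of_injective
    (LinearMap.codRestrict (LinearMap.range h)
      (LinearMap.toSpanSingleton (LeavittAlgebra K n) _ (toGerm T (0, 1)))
      (fun s => Submodule.smul_mem _ s hmem)) ?_
  intro a b hab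
  exact hinj (congrArg Subtype.val hab)

end FiniteStable

/-! ## The trivial module -/

section Trivial

variable {K : Type u} [Field K] {n : ℕ}

theorem exists_sub_algebraMap_mem_augIdeal (r : LambdaStar K n) :
    ∃ k : K, r - algebraMap K _ k ∈ augIdeal K n := by
  induction r using FreeAlgebra.induction with
  | grade0 k => exact ⟨k, by simp⟩
  | grade1 i => exact ⟨0, by
      rw [map_zero, sub_zero]
      exact Ideal.subset_span ⟨i, rfl⟩⟩
  | mul a b ha hb =>
    obtain ⟨k, hk⟩ := ha
    obtain ⟨l, hl⟩ := hb
    refine ⟨k * l, ?_⟩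
    have : a * b - algebraMap K _ (k * l) = a * (b - algebraMap K _ l) +
        algebraMap K _ l * (a - algebraMap K _ k) := by
      rw [Algebra.commutes, map_mul]
      noncomm_ring
    rw [this]
    exact add_mem (Ideal.mul_mem_left _ _ hl) (Ideal.mul_mem_left _ _ hk)
  | add a b ha hb =>
    obtain ⟨k, hk⟩ := ha
    obtain ⟨l, hl⟩ := hb
    refine ⟨k + l, ?_⟩
    rw [map_add, add_sub_add_comm]
    exact add_mem hk hl

theorem augIdeal_le_iff {J : Ideal (LambdaStar K n)} :
    augIdeal K n ≤ J ↔ ∀ i, FreeAlgebra.ι K i ∈ J := by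
  rw [augIdeal, Ideal.span_le, Set.range_subset_iff]
  rfl

theorem smul_eq_zero_of_mem_augIdeal {S : Type u} [AddCommGroup S] [Module (LambdaStar K n) S]
    (h : ∀ (i : Fin n) (s : S), (FreeAlgebra.ι K i : LambdaStar K n) • s = 0)
    {r : LambdaStar K n} (hr : r ∈ augIdeal K n) (s : S) : r • s = 0 :=
  (augIdeal_le_iff (J := LinearMap.ker (LinearMap.toSpanSingleton (LambdaStar K n) S s))).2
    (fun i => h i s) hr

theorem ι_smul_trivialModule (i : Fin n) (s : TrivialModule K n) :
    (FreeAlgebra.ι K i : LambdaStar K n) • s = 0 := by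
  obtain ⟨r, rfl⟩ := Submodule.Quotient.mk_surjective _ s
  obtain ⟨k, hk⟩ := exists_sub_algebraMap_mem_augIdeal r
  refine (Submodule.Quotient.mk_eq_zero _).2 ?_
  change FreeAlgebra.ι K i * r ∈ augIdeal K n
  rw [← sub_add_cancel r (algebraMap K _ k), mul_add, ← Algebra.commutes k]
  exact add_mem (Ideal.mul_mem_left _ _ hk)
    (Ideal.mul_mem_left _ _ (Ideal.subset_span ⟨i, rfl⟩))

/-- A simple module is trivial if and only if all variables act by zero. -/
theorem nonempty_equiv_trivialModule_iff {S : Type u} [AddCommGroup S] [Module (LambdaStar K n) S]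
    [IsSimpleModule (LambdaStar K n) S] :
    Nonempty (S ≃ₗ[LambdaStar K n] TrivialModule K n) ↔
      ∀ (i : Fin n) (s : S), (FreeAlgebra.ι K i : LambdaStar K n) • s = 0 := by
  refine ⟨fun ⟨e⟩ i s => e.injective ?_, fun h => ?_⟩
  · rw [map_smul, ι_smul_trivialModule, map_zero]
  · have := IsSimpleModule.nontrivial (LambdaStar K n) S
    obtain ⟨s, hs⟩ := exists_ne (0 : S)
    have hsurj := IsSimpleModule.toSpanSingleton_surjective (LambdaStar K n) hs
    have hker : LinearMap.ker (LinearMap.toSpanSingleton (LambdaStar K n) S s) =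
        augIdeal K n := by
      refine le_antisymm (fun r hr => ?_) (augIdeal_le_iff.2 fun i => h i s)
      obtain ⟨k, hk⟩ := exists_sub_algebraMap_mem_augIdeal r
      have hr' : r • s = 0 := hr
      have h0 : algebraMap K (LambdaStar K n) k • s = 0 := by
        have := smul_eq_zero_of_mem_augIdeal h hk s
        rwa [sub_smul, hr', zero_sub, neg_eq_zero] at this
      have hk0 : k = 0 := by
        by_contra hk0
        refine hs ?_
        rw [← one_smul (LambdaStar K n) s, ← map_one (algebraMap K (LambdaStar K n)),
          ← inv_mul_cancel₀ hk0, map_mul, mul_smul, h0, smul_zero]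
      simpa [hk0] using hk
    exact ⟨((Submodule.quotEquivOfEq _ _ hker.symm).trans
      (LinearMap.quotKerEquivOfSurjective _ hsurj)).symm⟩

end Trivial

/-! ## Leavitt-torsion modules and Leavitt modules -/

section Torsion

variable {K : Type u} [Field K] {n : ℕ}
variable {M : Type u} [AddCommGroup M] [Module (LambdaStar K n) M]

/-- `m` is mapped into `N` by all sufficiently long words in the variables. -/
abbrev TorsionMod (N : Submodule (LambdaStar K n) M) (m : M) : Prop :=
  Sat (iotaAct (K := K) (n := n) M) N m

/-- The elements that are torsion modulo `N`. -/
def satSub (N : Submodule (LambdaStar K n) M) : Submodule (LambdaStar K n) M :=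
  have hadd : ∀ {a b : M}, TorsionMod N a → TorsionMod N b → TorsionMod N (a + b) :=
    Sat.add (fun _ _ _ => smul_add _ _ _) (fun _ _ hm => N.smul_mem _ hm)
      (fun _ ha _ hb => N.add_mem ha hb)
  have hK : ∀ (k : K) (y : M), TorsionMod N y →
      TorsionMod N (algebraMap K (LambdaStar K n) k • y) := by
    intro k y hy
    refine hy.map (fun y => algebraMap K (LambdaStar K n) k • y) (fun i m => ?_)
      (fun m hm => Sat.mem (N.smul_mem _ hm))
    simp only [iotaAct, smul_smul, Algebra.commutes]
  { carrier := {y | TorsionMod N y}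
    add_mem' := hadd
    zero_mem' := Sat.mem N.zero_mem
    smul_mem' := fun r y hy => lambdaStar_smul_mem
      { carrier := {y | TorsionMod N y}
        add_mem' := hadd
        zero_mem' := Sat.mem N.zero_mem
        neg_mem' := fun {y} hy => by
          have := hK (-1) y hy
          simpa using this } hK
      (fun i y hy => hy.apply (fun i m hm => N.smul_mem (FreeAlgebra.ι K i) hm) i) r y hy }

theorem mem_satSub {N : Submodule (LambdaStar K n) M} {m : M} :
    m ∈ satSub N ↔ TorsionMod N m := Iff.rfl

/-- The elements of `P` that all variables send into `N` form a submodule `Q` between `N` and `P`.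
If `Q` were `N`, descending along words would put all of `P` into `N`; hence `Q = P`. -/
theorem ι_smul_mem_of_torsionMod {N P : Submodule (LambdaStar K n) M} (h : N ⋖ P)
    (hP : ∀ p ∈ P, TorsionMod N p) (i : Fin n) {p : M} (hp : p ∈ P) :
    (FreeAlgebra.ι K i : LambdaStar K n) • p ∈ N := by
  let Q₀ : AddSubgroup M :=
    { carrier := {p | p ∈ P ∧ ∀ i, (FreeAlgebra.ι K i : LambdaStar K n) • p ∈ N}
      add_mem' := fun ha hb => ⟨add_mem ha.1 hb.1, fun i => by
        rw [smul_add]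
        exact add_mem (ha.2 i) (hb.2 i)⟩
      zero_mem' := ⟨zero_mem _, fun i => by simp⟩
      neg_mem' := fun ha => ⟨neg_mem ha.1, fun i => by
        rw [smul_neg]
        exact neg_mem (ha.2 i)⟩ }
  let Q : Submodule (LambdaStar K n) M :=
    { Q₀ with
      smul_mem' := fun r y hy => lambdaStar_smul_mem Q₀
        (fun k y hy => ⟨P.smul_mem _ hy.1, fun i => by
          rw [smul_smul, ← Algebra.commutes, mul_smul]
          exact N.smul_mem _ (hy.2 i)⟩)
        (fun j y hy => ⟨P.smul_mem _ hy.1, fun i => N.smul_mem _ (hy.2 j)⟩) r y hy }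
  have hNQ : N ≤ Q := fun x hx => ⟨h.le hx, fun i => N.smul_mem _ hx⟩
  have hQP : Q ≤ P := fun x hx => hx.1
  rcases h.eq_or_eq hNQ hQP with hQ | hQ
  · exfalso
    refine h.lt.not_ge fun x hx => ?_
    have hs := hP x hx
    induction hs with
    | mem hm => exact hm
    | step _ ih =>
      rw [← hQ]
      exact ⟨hx, fun i => ih i (P.smul_mem _ hx)⟩
  · rw [← hQ] at hp
    exact hp.2 i

/-- A simple subfactor is trivial if and only if the variables map its top into its bottom. -/
theorem nonempty_subfactor_equiv_iff {N P : Submodule (LambdaStar K n) M}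
    [IsSimpleModule (LambdaStar K n) (P ⧸ N.submoduleOf P)] :
    Nonempty ((P ⧸ N.submoduleOf P) ≃ₗ[LambdaStar K n] TrivialModule K n) ↔
      ∀ (i : Fin n), ∀ p ∈ P, (FreeAlgebra.ι K i : LambdaStar K n) • p ∈ N := by
  rw [nonempty_equiv_trivialModule_iff]
  refine forall_congr' fun i => ⟨fun h p hp => ?_, fun h s => ?_⟩
  · exact (Submodule.Quotient.mk_eq_zero (N.submoduleOf P)).1
      (h (Submodule.Quotient.mk (p := N.submoduleOf P) ⟨p, hp⟩))
  · obtain ⟨p, rfl⟩ := Submodule.Quotient.mk_surjective _ s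
    exact (Submodule.Quotient.mk_eq_zero (N.submoduleOf P)).2 (h p p.2)

theorem not_forall_torsionMod
    (h : ∀ N P : Submodule (LambdaStar K n) M, N ≤ P →
      IsSimpleModule (LambdaStar K n) (P ⧸ N.submoduleOf P) →
      IsEmpty ((P ⧸ N.submoduleOf P) ≃ₗ[LambdaStar K n] TrivialModule K n))
    {N P : Submodule (LambdaStar K n) M} (hNP : N ⋖ P) :
    ¬ ∀ p ∈ P, TorsionMod N p := by
  intro hP
  have hsimple : IsSimpleModule (LambdaStar K n) (P ⧸ N.submoduleOf P) :=
    (covBy_iff_quot_is_simple hNP.le).1 hNP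
  refine not_nonempty_iff.2 (h N P hNP.le hsimple) ?_
  exact nonempty_subfactor_equiv_iff.2 fun i p hp => ι_smul_mem_of_torsionMod hNP hP i hp

section FiniteDimensional

variable [Module K M] [IsScalarTower K (LambdaStar K n) M] [Module.Finite K M]

variable (K n M) in
theorem isNoetherian_of_finiteDim : IsNoetherian (LambdaStar K n) M :=
  isNoetherian_of_tower K inferInstance

variable (K n M) in
theorem isArtinian_of_finiteDim : IsArtinian (LambdaStar K n) M :=
  isArtinian_of_tower K inferInstance

variable (K n M) in
-- If the saturation of `0` were proper, the artinian property would give a simple subfactor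
-- directly above it. When that subfactor is trivial, one more letter puts it inside the saturation,
-- a contradiction.
theorem forall_subfactor_trivial_iff :
    (∀ N P : Submodule (LambdaStar K n) M, N ≤ P →
      IsSimpleModule (LambdaStar K n) (P ⧸ N.submoduleOf P) →
      Nonempty ((P ⧸ N.submoduleOf P) ≃ₗ[LambdaStar K n] TrivialModule K n)) ↔
    ∀ m : M, Sat (iotaAct (K := K) (n := n) M) {0} m := by
  have := isArtinian_of_finiteDim K n M
  constructor
  · intro h
    by_contra! hcon
    obtain ⟨m, hm⟩ := hcon
    have hne : satSub (⊥ : Submodule (LambdaStar K n) M) ≠ ⊤ := fun he =>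
      hm (mem_satSub.1 (he ▸ Submodule.mem_top : m ∈ satSub ⊥))
    obtain ⟨P, hP⟩ := exists_covBy_of_wellFoundedLT (fun hmax => hne hmax.eq_top)
    have hsimple : IsSimpleModule (LambdaStar K n) (P ⧸ (satSub ⊥).submoduleOf P) :=
      (covBy_iff_quot_is_simple hP.le).1 hP
    have key := nonempty_subfactor_equiv_iff.1 (h _ P hP.le hsimple)
    exact hP.lt.not_ge fun p hp => mem_satSub.2 (Sat.step fun i => mem_satSub.1 (key i p hp))
  · intro h N P hNP hsimple
    have hcov := (covBy_iff_quot_is_simple hNP).2 hsimple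
    refine nonempty_subfactor_equiv_iff.2 fun i p hp =>
      ι_smul_mem_of_torsionMod hcov (fun p _ => (h p).mono ?_) i hp
    rintro _ rfl
    exact N.zero_mem

/-- An atom below the torsion submodule would be a trivial simple submodule. -/
theorem eq_zero_of_torsion
    (h : ∀ N P : Submodule (LambdaStar K n) M, N ≤ P →
      IsSimpleModule (LambdaStar K n) (P ⧸ N.submoduleOf P) →
      IsEmpty ((P ⧸ N.submoduleOf P) ≃ₗ[LambdaStar K n] TrivialModule K n))
    {m : M} (hm : Sat (iotaAct (K := K) (n := n) M) {0} m) : m = 0 := by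
  have := isArtinian_of_finiteDim K n M
  have hbot : satSub (⊥ : Submodule (LambdaStar K n) M) = ⊥ := by
    rcases eq_bot_or_exists_atom_le (satSub (⊥ : Submodule (LambdaStar K n) M)) with h0 | ⟨P, hP, hle⟩
    · exact h0
    · exact absurd (fun p hp => hle hp) (not_forall_torsionMod h (bot_covBy_iff.2 hP))
  exact (Submodule.mem_bot (LambdaStar K n)).1 (hbot ▸ hm)

/-- Dual to `eq_zero_of_torsion`: a coatom above `N` would give a trivial simple quotient. -/
theorem eq_top_of_torsionMod
    (h : ∀ N P : Submodule (LambdaStar K n) M, N ≤ P →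
      IsSimpleModule (LambdaStar K n) (P ⧸ N.submoduleOf P) →
      IsEmpty ((P ⧸ N.submoduleOf P) ≃ₗ[LambdaStar K n] TrivialModule K n))
    {N : Submodule (LambdaStar K n) M} (hN : ∀ m, TorsionMod N m) :
    N = ⊤ := by
  have := isNoetherian_of_finiteDim K n M
  rcases eq_top_or_exists_le_coatom N with h0 | ⟨P, hP, hle⟩
  · exact h0
  · exact absurd (fun p _ => (hN p).mono hle) (not_forall_torsionMod h (covBy_top_iff.2 hP))

end FiniteDimensional

end Torsion

/-! ## A criterion for localizations with a calculus of fractions -/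

section Localization

variable {C D E : Type*} [Category* C] [Category* D] [Category* E]

theorem full_of_precomp_essSurj (L : C ⥤ D) [L.EssSurj] (G : D ⥤ E)
    (h : ∀ {X Y : C} (ψ : G.obj (L.obj X) ⟶ G.obj (L.obj Y)), ∃ φ, G.map φ = ψ) : G.Full where
  map_surjective {A B} ψ := by
    let a := L.objObjPreimageIso A
    let b := L.objObjPreimageIso B
    obtain ⟨φ, hφ⟩ := h (G.map a.hom ≫ ψ ≫ G.map b.inv)
    refine ⟨a.inv ≫ φ ≫ b.hom, ?_⟩
    rw [G.map_comp, G.map_comp, hφ]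
    simp only [Category.assoc, ← G.map_comp, Iso.inv_hom_id]
    simp [← G.map_comp_assoc]

theorem faithful_of_precomp_essSurj (L : C ⥤ D) [L.EssSurj] (G : D ⥤ E)
    (h : ∀ {X Y : C} (φ ψ : L.obj X ⟶ L.obj Y), G.map φ = G.map ψ → φ = ψ) : G.Faithful where
  map_injective {A B} φ ψ hφψ := by
    let a := L.objObjPreimageIso A
    let b := L.objObjPreimageIso B
    have := h (a.hom ≫ φ ≫ b.inv) (a.hom ≫ ψ ≫ b.inv) (by simp [hφψ])
    simpa using this

/-- The comparison functor `G` from the localization is shown to be an equivalence. Right fractions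
in `D` make it full. For faithfulness, the left calculus gives two parallel morphisms a common
denominator, so that only numerators, which are morphisms of `C`, have to be compared. -/
theorem isLocalization_of_exists_rightFraction (F : C ⥤ D) (W : MorphismProperty C)
    [W.HasLeftCalculusOfFractions] [F.EssSurj] (hW : W.IsInvertedBy F)
    (hfull : ∀ {X Y : C} (φ : F.obj X ⟶ F.obj Y), ∃ (Z : C) (s : Z ⟶ X) (g : Z ⟶ Y),
      W s ∧ F.map s ≫ φ = F.map g)
    (hfaithful : ∀ {X Y : C} (f g : X ⟶ Y), F.map f = F.map g →
      ∃ (Z : C) (s : Z ⟶ X), W s ∧ s ≫ f = s ≫ g) :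
    F.IsLocalization W := by
  let G : W.Localization ⥤ D := Localization.lift F hW W.Q
  let e : W.Q ⋙ G ≅ F := Localization.fac F hW W.Q
  have : W.Q.EssSurj := Localization.essSurj W.Q W
  have : G.Full := full_of_precomp_essSurj W.Q G fun {X Y} ψ => by
    obtain ⟨Z, s, g, hs, h⟩ := hfull (e.inv.app X ≫ ψ ≫ e.hom.app Y)
    have : IsIso (W.Q.map s) := Localization.inverts W.Q W s hs
    refine ⟨inv (W.Q.map s) ≫ W.Q.map g, ?_⟩
    rw [G.map_comp, G.map_inv, IsIso.inv_comp_eq, ← cancel_mono (e.hom.app Y)]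
    have h1 := e.hom.naturality s
    have h2 := e.hom.naturality g
    simp only [Functor.comp_map] at h1 h2
    rw [h2, ← h, ← Category.assoc, ← h1]
    simp
  have : G.Faithful := faithful_of_precomp_essSurj W.Q G fun {X Y} a b hab => by
    obtain ⟨φ, rfl, rfl⟩ := Localization.exists_leftFraction₂ W.Q W a b
    have hs : IsIso (W.Q.map φ.s) := Localization.inverts W.Q W φ.s φ.hs
    have h1 := φ.fst.map_comp_map_s W.Q (Localization.inverts _ _)
    have h2 := φ.snd.map_comp_map_s W.Q (Localization.inverts _ _)
    rw [← cancel_mono (W.Q.map φ.s)]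
    refine h1.trans (Eq.trans ?_ h2.symm)
    have h3 : G.map (W.Q.map φ.f) = G.map (W.Q.map φ.f') := by
      refine ((congrArg G.map h1).symm.trans ?_).trans (congrArg G.map h2)
      rw [G.map_comp, G.map_comp, hab]
    have h4 : F.map φ.f = F.map φ.f' := by
      rw [← cancel_epi (e.hom.app X)]
      have n1 := e.hom.naturality φ.f
      have n2 := e.hom.naturality φ.f'
      simp only [Functor.comp_map] at n1 n2
      rw [← n1, ← n2, h3]
    obtain ⟨Z, s, hs, h⟩ := hfaithful _ _ h4
    have : IsIso (W.Q.map s) := Localization.inverts W.Q W s hs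
    rw [← cancel_epi (W.Q.map s), ← Functor.map_comp, h, Functor.map_comp]
  have : G.EssSurj := ⟨fun Y => ⟨W.Q.obj (F.objPreimage Y), ⟨e.app _ ≪≫ F.objObjPreimageIso Y⟩⟩⟩
  have : G.IsEquivalence := { }
  exact Functor.IsLocalization.of_equivalence_target W.Q W F G.asEquivalence e

end Localization

/-! ## Finite-dimensional modules -/

section FiniteDim

variable {K : Type u} [Field K] {A : Type u} [Ring A] [Algebra K A]

/-- A submodule of a finite-dimensional module. -/
abbrev fdSub (M : (isFiniteDim K A).FullSubcategory) (N : Submodule A M.obj) :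
    (isFiniteDim K A).FullSubcategory :=
  ⟨ModuleCat.of A N,
    have : Mono (ModuleCat.ofHom N.subtype) :=
      (ModuleCat.mono_iff_injective _).2 N.injective_subtype
    (isFiniteDim K A).prop_of_mono (ModuleCat.ofHom N.subtype) M.property⟩

/-- The inclusion of a submodule. -/
abbrev fdSubι (M : (isFiniteDim K A).FullSubcategory) (N : Submodule A M.obj) : fdSub M N ⟶ M :=
  ObjectProperty.homMk (ModuleCat.ofHom N.subtype)

/-- A quotient of a finite-dimensional module. -/
abbrev fdQuot (M : (isFiniteDim K A).FullSubcategory) (N : Submodule A M.obj) :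
    (isFiniteDim K A).FullSubcategory :=
  ⟨ModuleCat.of A (M.obj ⧸ N),
    have : Epi (ModuleCat.ofHom N.mkQ) :=
      (ModuleCat.epi_iff_surjective _).2 N.mkQ_surjective
    (isFiniteDim K A).prop_of_epi (ModuleCat.ofHom N.mkQ) M.property⟩

/-- The projection to a quotient. -/
abbrev fdQuotπ (M : (isFiniteDim K A).FullSubcategory) (N : Submodule A M.obj) : M ⟶ fdQuot M N :=
  ObjectProperty.homMk (ModuleCat.ofHom N.mkQ)

variable {X Y : (isFiniteDim K A).FullSubcategory}

theorem fd_comp_eq_zero_iff {Z : (isFiniteDim K A).FullSubcategory} (f : X ⟶ Y) (g : Y ⟶ Z) :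
    f ≫ g = 0 ↔ ∀ x : X.obj, g.hom.hom (f.hom.hom x) = 0 := by
  refine ⟨fun h x => ?_, fun h => ?_⟩
  · exact congrArg (fun k : X ⟶ Z => k.hom.hom x) h
  · ext x
    exact h x

/-- Monomorphy is given only inside the full subcategory, so it is tested against the kernel
submodule, which is again finite-dimensional. -/
theorem fd_injective_of_mono (f : X ⟶ Y) [Mono f] : Function.Injective f.hom.hom := by
  have h : fdSubι X (LinearMap.ker f.hom.hom) = 0 := by
    rw [← cancel_mono f, Limits.zero_comp, fd_comp_eq_zero_iff]
    exact fun x => x.2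
  refine (injective_iff_map_eq_zero f.hom.hom).2 fun x hx => ?_
  exact congrArg (fun k : fdSub X (LinearMap.ker f.hom.hom) ⟶ X => k.hom.hom ⟨x, hx⟩) h

theorem fd_surjective_of_epi (f : X ⟶ Y) [Epi f] : Function.Surjective f.hom.hom := by
  have h : fdQuotπ Y (LinearMap.range f.hom.hom) = 0 := by
    rw [← cancel_epi f, Limits.comp_zero, fd_comp_eq_zero_iff]
    exact fun x => (Submodule.Quotient.mk_eq_zero _).2 ⟨x, rfl⟩
  intro y
  exact (Submodule.Quotient.mk_eq_zero _).1
    (congrArg (fun k : Y ⟶ fdQuot Y (LinearMap.range f.hom.hom) => k.hom.hom y) h)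

theorem fd_exists_of_shortExact {S : ShortComplex (isFiniteDim K A).FullSubcategory}
    (hS : S.ShortExact) {x : S.X₂.obj} (hx : S.g.hom.hom x = 0) :
    ∃ y, S.f.hom.hom y = x := by
  have := hS.mono_f
  let i := fdSubι S.X₂ (LinearMap.ker S.g.hom.hom)
  have hi : i ≫ S.g = 0 := (fd_comp_eq_zero_iff _ _).2 fun x => x.2
  have h : hS.exact.lift i hi ≫ S.f = i := hS.exact.lift_f i hi
  exact ⟨(hS.exact.lift i hi).hom.hom ⟨x, hx⟩,
    congrArg (fun k : fdSub S.X₂ (LinearMap.ker S.g.hom.hom) ⟶ S.X₂ => k.hom.hom ⟨x, hx⟩) h⟩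

end FiniteDim

/-! ## The Serre subcategory of Leavitt-torsion modules -/

section Serre

variable {K : Type u} [Field K] {n : ℕ}

variable (K n) in
/-- The category of finite-dimensional modules over the free algebra. -/
abbrev FDMod := (isFiniteDim K (LambdaStar K n)).FullSubcategory

theorem isLeavittTorsion_iff (M : FDMod K n) :
    isLeavittTorsion K n M ↔ ∀ m, Sat (iotaAct (K := K) (n := n) M.obj) {0} m :=
  have : Module.Finite K M.obj := M.property
  forall_subfactor_trivial_iff K n M.obj

theorem iotaAct_map {M M' : Type u} [AddCommGroup M] [Module (LambdaStar K n) M]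
    [AddCommGroup M'] [Module (LambdaStar K n) M'] (f : M →ₗ[LambdaStar K n] M') (i : Fin n)
    (m : M) : f (iotaAct (K := K) (n := n) M i m) = iotaAct (K := K) (n := n) M' i (f m) :=
  map_smul f _ m

variable (K n) in
instance isLeavittTorsion_isSerreClass : (isLeavittTorsion K n).IsSerreClass where
  exists_zero := by
    obtain ⟨Z, hZ⟩ := Limits.HasZeroObject.zero (C := FDMod K n)
    refine ⟨Z, hZ, (isLeavittTorsion_iff _).2 fun m => .mem ?_⟩
    exact congrArg (fun k : Z ⟶ Z => k.hom.hom m) (hZ.eq_of_src (𝟙 _) 0)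
  prop_of_mono f _ h := by
    rw [isLeavittTorsion_iff] at h ⊢
    refine fun m => (h (f.hom.hom m)).comap f.hom.hom (iotaAct_map _) fun m hm => .mem ?_
    exact fd_injective_of_mono f (hm.trans (map_zero f.hom.hom).symm)
  prop_of_epi f _ h := by
    rw [isLeavittTorsion_iff] at h ⊢
    intro m
    obtain ⟨m, rfl⟩ := fd_surjective_of_epi f m
    refine (h m).map f.hom.hom (iotaAct_map _) ?_
    rintro _ rfl
    exact .mem (map_zero f.hom.hom)
  prop_X₂_of_shortExact {S} hS h₁ h₃ := by
    rw [isLeavittTorsion_iff] at h₁ h₃ ⊢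
    refine fun m => (h₃ (S.g.hom.hom m)).comap S.g.hom.hom (iotaAct_map _) fun m hm => ?_
    obtain ⟨y, rfl⟩ := fd_exists_of_shortExact hS hm
    refine (h₁ y).map S.f.hom.hom (iotaAct_map _) ?_
    rintro _ rfl
    exact .mem (map_zero S.f.hom.hom)

/-- Translates the categorical kernel and cokernel, known only by their universal properties, into
elements: the concrete kernel and the quotient by the range supply the test maps. -/
theorem isoModSerre_isLeavittTorsion_iff {X Y : FDMod K n} (f : X ⟶ Y) :
    (isLeavittTorsion K n).isoModSerre f ↔
      (∀ x, f.hom.hom x = 0 → Sat (iotaAct (K := K) (n := n) X.obj) {0} x) ∧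
      ∀ y, TorsionMod (LinearMap.range f.hom.hom) y := by
  rw [ObjectProperty.isoModSerre_iff, ObjectProperty.monoModSerre_iff,
    ObjectProperty.epiModSerre_iff, isLeavittTorsion_iff, isLeavittTorsion_iff]
  refine and_congr ⟨fun h x hx => ?_, fun h x => ?_⟩ ⟨fun h y => ?_, fun h y => ?_⟩
  · let i := fdSubι X (LinearMap.ker f.hom.hom)
    have hi : i ≫ f = 0 := (fd_comp_eq_zero_iff _ _).2 fun x => x.2
    have hx' : (Limits.kernel.ι f).hom.hom ((Limits.kernel.lift f i hi).hom.hom ⟨x, hx⟩) = x :=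
      congrArg (fun k : fdSub X (LinearMap.ker f.hom.hom) ⟶ X => k.hom.hom ⟨x, hx⟩)
        (Limits.kernel.lift_ι f i hi)
    rw [← hx']
    refine (h _).map (Limits.kernel.ι f).hom.hom (iotaAct_map _) ?_
    rintro _ rfl
    exact .mem (map_zero (Limits.kernel.ι f).hom.hom)
  · refine (h _ ((fd_comp_eq_zero_iff _ _).1 (Limits.kernel.condition f) x)).comap
      (Limits.kernel.ι f).hom.hom (iotaAct_map _) fun m hm => .mem ?_
    exact fd_injective_of_mono _ (hm.trans (map_zero (Limits.kernel.ι f).hom.hom).symm)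
  · let p := fdQuotπ Y (LinearMap.range f.hom.hom)
    have hp : f ≫ p = 0 := (fd_comp_eq_zero_iff _ _).2 fun x =>
      (Submodule.Quotient.mk_eq_zero _).2 ⟨x, rfl⟩
    have hd : ∀ y, (Limits.cokernel.desc f p hp).hom.hom ((Limits.cokernel.π f).hom.hom y) =
        p.hom.hom y := fun y =>
      congrArg (fun k : Y ⟶ fdQuot Y (LinearMap.range f.hom.hom) => k.hom.hom y)
        (Limits.cokernel.π_desc f p hp)
    refine (h ((Limits.cokernel.π f).hom.hom y)).comap (Limits.cokernel.π f).hom.hom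
      (iotaAct_map _) fun m hm => .mem ?_
    refine (Submodule.Quotient.mk_eq_zero _).1 ((hd m).symm.trans ?_)
    rw [show (Limits.cokernel.π f).hom.hom m = 0 from hm, map_zero]
  · obtain ⟨y, rfl⟩ := fd_surjective_of_epi (Limits.cokernel.π f) y
    refine (h y).map (Limits.cokernel.π f).hom.hom (iotaAct_map _) ?_
    rintro _ ⟨x, rfl⟩
    exact .mem ((fd_comp_eq_zero_iff _ _).1 (Limits.cokernel.condition f) x)

end Serre

/-! ## Morphisms between modules extended to the Leavitt algebra -/

section Graph

variable {K : Type u} [Field K] {n : ℕ}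
variable {M M' : Type u} [AddCommGroup M] [Module (LambdaStar K n) M]
variable [AddCommGroup M'] [Module (LambdaStar K n) M']

/-- All pairs `(m, m')` such that `φ (1 ⊗ m) = 1 ⊗ m'`. -/
def tensorGraph
    (φ : TensorOver (toLeavitt K n) M →ₗ[LeavittAlgebra K n] TensorOver (toLeavitt K n) M') :
    Submodule (LambdaStar K n) (M × M') where
  carrier := {x | φ (tunit K n M x.1) = tunit K n M' x.2}
  add_mem' {a b} ha hb := by
    simp only [Set.mem_ofPred_eq, Prod.fst_add, Prod.snd_add, map_add] at *
    rw [ha, hb]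
  zero_mem' := by simp
  smul_mem' r a ha := by
    simp only [Set.mem_ofPred_eq, Prod.smul_fst, Prod.smul_snd, map_smulₛₗ] at *
    rw [ha]
    rfl

variable (φ : TensorOver (toLeavitt K n) M →ₗ[LeavittAlgebra K n] TensorOver (toLeavitt K n) M')

theorem mem_tensorGraph {x : M × M'} :
    x ∈ tensorGraph φ ↔ φ (tunit K n M x.1) = tunit K n M' x.2 := Iff.rfl

/-- The first projection of the graph. -/
abbrev graphFst : tensorGraph φ →ₗ[LambdaStar K n] M :=
  LinearMap.fst _ _ _ ∘ₗ (tensorGraph φ).subtype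

/-- The second projection of the graph. -/
abbrev graphSnd : tensorGraph φ →ₗ[LambdaStar K n] M' :=
  LinearMap.snd _ _ _ ∘ₗ (tensorGraph φ).subtype

/-- Long words map `φ (1 ⊗ m)` into the image of `M'`, that is, they map `m` into the domain of the
graph. -/
theorem torsionMod_range_graphFst (m : M) : TorsionMod (LinearMap.range (graphFst φ)) m := by
  refine (sat_range_tunit (φ (tunit K n M m))).comap (fun m => φ (tunit K n M m))
    (fun i m => ?_) ?_
  · rw [semilinear_iota, xsAct, xsAct, map_smul]
  · rintro m ⟨m', hm'⟩
    exact .mem ⟨⟨(m, m'), hm'.symm⟩, rfl⟩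

/-- A pair `(0, m')` in the graph has `1 ⊗ m' = 0`, so `m'` is torsion. -/
theorem torsion_of_graphFst_eq_zero {x : tensorGraph φ} (hx : graphFst φ x = 0) :
    Sat (iotaAct (K := K) (n := n) (tensorGraph φ)) {0} x := by
  obtain ⟨⟨m, m'⟩, hmm⟩ := x
  obtain rfl : m = 0 := hx
  have hm' : tunit K n M' m' = 0 := by
    rw [← hmm, map_zero, map_zero]
  refine Sat.comap (T' := iotaAct (K := K) (n := n) (M × M')) (V' := {0})
    (tensorGraph φ).subtype (iotaAct_map _) (fun x hx => .mem (Submodule.coe_eq_zero.1 hx)) ?_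
  refine (sat_of_tunit_eq_zero hm').map (LinearMap.inr (LambdaStar K n) M M') (iotaAct_map _) ?_
  rintro _ rfl
  exact .mem rfl

theorem comp_map_graphFst :
    φ ∘ₗ TensorOver.map (toLeavitt K n) (graphFst φ) =
      TensorOver.map (toLeavitt K n) (graphSnd φ) :=
  TensorOver.ext_unit _ fun x => x.2

theorem torsion_sub_of_map_eq {f g : M →ₗ[LambdaStar K n] M'}
    (h : TensorOver.map (toLeavitt K n) f = TensorOver.map (toLeavitt K n) g) (m : M) :
    Sat (iotaAct (K := K) (n := n) M') {0} (f m - g m) := by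
  refine sat_of_tunit_eq_zero ?_
  rw [map_sub, sub_eq_zero]
  exact LinearMap.congr_fun h (tunit K n M m)

/-- No flatness is invoked: injectivity is tested on the image of `M`, where vanishing means
torsion, and surjectivity follows because the image of `M'` is saturated into the range. -/
theorem bijective_map_of_torsion (f : M →ₗ[LambdaStar K n] M')
    (hker : ∀ x, f x = 0 → Sat (iotaAct (K := K) (n := n) M) {0} x)
    (hrange : ∀ y, TorsionMod (LinearMap.range f) y) :
    Function.Bijective (TensorOver.map (toLeavitt K n) f) := by
  constructor
  · refine injective_of_tunit _ fun m hm => tunit_eq_zero_of_sat ?_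
    refine (sat_of_tunit_eq_zero (m := f m) hm).comap f (iotaAct_map f) fun m hm => hker m hm
  · rw [← LinearMap.range_eq_top, eq_top_iff, ← TensorOver.span_range_unit, Submodule.span_le]
    rintro _ ⟨y, rfl⟩
    refine mem_of_sat (LinearMap.range (TensorOver.map (toLeavitt K n) f))
      (E := LinearMap.range (TensorOver.map (toLeavitt K n) f)) subset_rfl
      ((hrange y).map (tunit K n M') (semilinear_iota _) ?_)
    rintro _ ⟨x, rfl⟩
    exact .mem ⟨tunit K n M x, rfl⟩

end Graph

/-! ## The functor to finitely presented modules of finite length -/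

section Functor

variable {K : Type u} [Field K] {n : ℕ}

theorem isFPL_leavittFunctor (M : FDMod K n) :
    isFPL (LeavittAlgebra K n)
      (((isFiniteDim K (LambdaStar K n)).ι ⋙ leavittFunctor K n).obj M) :=
  have : Module.Finite K M.obj := M.property
  ⟨finitePresentation_tensor (M := M.obj), isFiniteLength_tensor (M := M.obj)⟩

variable (K n) in
/-- The functor from finite-dimensional modules to finitely presented modules of finite length. -/
abbrev fplFunctor : FDMod K n ⥤ (isFPL (LeavittAlgebra K n)).FullSubcategory :=
  (isFPL (LeavittAlgebra K n)).lift
    ((isFiniteDim K (LambdaStar K n)).ι ⋙ leavittFunctor K n) isFPL_leavittFunctor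

theorem isInvertedBy_fplFunctor :
    (isLeavittTorsion K n).isoModSerre.IsInvertedBy (fplFunctor K n) := by
  intro X Y f hf
  rw [isoModSerre_isLeavittTorsion_iff] at hf
  rw [← ObjectProperty.isIso_hom_iff]
  exact (ConcreteCategory.isIso_iff_bijective _).2
    (bijective_map_of_torsion f.hom.hom hf.1 hf.2)

theorem exists_rightFraction_fplFunctor {X Y : FDMod K n}
    (φ : (fplFunctor K n).obj X ⟶ (fplFunctor K n).obj Y) :
    ∃ (Z : FDMod K n) (s : Z ⟶ X) (g : Z ⟶ Y), (isLeavittTorsion K n).isoModSerre s ∧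
      (fplFunctor K n).map s ≫ φ = (fplFunctor K n).map g := by
  have hX : Module.Finite K X.obj := X.property
  have hY : Module.Finite K Y.obj := Y.property
  let XY : FDMod K n := ⟨ModuleCat.of _ (X.obj × Y.obj),
    (inferInstance : Module.Finite K (X.obj × Y.obj))⟩
  refine ⟨fdSub XY (tensorGraph φ.hom.hom),
    ObjectProperty.homMk (ModuleCat.ofHom (graphFst φ.hom.hom)),
    ObjectProperty.homMk (ModuleCat.ofHom (graphSnd φ.hom.hom)), ?_, ?_⟩
  · rw [isoModSerre_isLeavittTorsion_iff]
    exact ⟨fun x hx => torsion_of_graphFst_eq_zero _ hx, torsionMod_range_graphFst φ.hom.hom⟩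
  · ext1
    exact ModuleCat.hom_ext (comp_map_graphFst φ.hom.hom)

/-- The witness is the inclusion of the equalizer of `f` and `g`. Its cokernel is torsion because
every `f x - g x` is. -/
theorem exists_comp_eq_of_fplFunctor_map_eq {X Y : FDMod K n} (f g : X ⟶ Y)
    (h : (fplFunctor K n).map f = (fplFunctor K n).map g) :
    ∃ (Z : FDMod K n) (s : Z ⟶ X), (isLeavittTorsion K n).isoModSerre s ∧ s ≫ f = s ≫ g := by
  let N := LinearMap.ker (f.hom.hom - g.hom.hom)
  refine ⟨fdSub X N, fdSubι X N, ?_, ?_⟩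
  · rw [isoModSerre_isLeavittTorsion_iff]
    refine ⟨fun x hx => .mem (Subtype.ext hx), fun x => ?_⟩
    have hx := torsion_sub_of_map_eq (congrArg (fun k => k.hom.hom) h) x
    refine Sat.comap (f.hom.hom - g.hom.hom) (iotaAct_map _) (fun m hm => .mem ?_) hx
    exact ⟨⟨m, hm⟩, rfl⟩
  · ext x
    exact sub_eq_zero.1 x.2

/-- A module over the Leavitt algebra that is generated by a finite-dimensional subspace that is
stable under all `xᵢ*` is induced from that subspace. -/
theorem exists_tensor_equiv_of_stable {N : Type u} [AddCommGroup N] [Module (LeavittAlgebra K n) N]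
    [Module K N] [IsScalarTower K (LeavittAlgebra K n) N] (V : Submodule K N)
    [Module.Finite K V] (hspan : Submodule.span (LeavittAlgebra K n) (V : Set N) = ⊤)
    (hstable : ∀ i, ∀ v ∈ V, leavittXs K n i • v ∈ V) :
    ∃ M : FDMod K n,
      Nonempty (TensorOver (toLeavitt K n) M.obj ≃ₗ[LeavittAlgebra K n] N) := by
  let _ : Module (LambdaStar K n) N := Module.compHom N (toLeavitt K n)
  have hsmul : ∀ (r : LambdaStar K n) (y : N), r • y = toLeavitt K n r • y := fun _ _ => rfl
  have hsmulK : ∀ (k : K) (y : N), algebraMap K (LambdaStar K n) k • y = k • y := fun k y => by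
    rw [hsmul, toLeavitt_algebraMap, algebraMap_smul]
  let V' : Submodule (LambdaStar K n) N :=
    { V with
      smul_mem' := fun r y hy => lambdaStar_smul_mem V.toAddSubgroup
        (fun k y hy => by
          rw [hsmulK]
          exact V.smul_mem k hy)
        (fun i y hy => by
          rw [hsmul, toLeavitt_ι]
          exact hstable i y hy) r y hy }
  -- Finite dimension refers to the `K`-structure through `Λ*`. The copy `M` keeps it apart from the
  -- structure inherited from `N` until the two are compared.
  obtain ⟨M, ⟨e⟩⟩ : ∃ M : ModuleCat.{u} (LambdaStar K n), Nonempty (V' ≃ₗ[LambdaStar K n] M) :=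
    ⟨ModuleCat.of _ V', ⟨LinearEquiv.refl _ _⟩⟩
  have hM : isFiniteDim K (LambdaStar K n) M := by
    let f : V →ₗ[K] M :=
      { toFun := fun v => e ⟨v.1, v.2⟩
        map_add' := fun v w => map_add e ⟨v.1, v.2⟩ ⟨w.1, w.2⟩
        map_smul' := fun k v => by
          rw [RingHom.id_apply, ← algebraMap_smul (LambdaStar K n) k (e _), ← map_smul]
          exact congrArg e (Subtype.ext (hsmulK k v.1).symm) }
    exact Module.Finite.of_surjective f fun m => ⟨⟨(e.symm m).1, (e.symm m).2⟩, by simp [f]⟩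
  let g : M →ₛₗ[toLeavitt K n] N :=
    { toFun := fun m => (e.symm m).1
      map_add' := fun a b => by rw [map_add]; rfl
      map_smul' := fun r m => by rw [map_smul]; rfl }
  let h := TensorOver.lift (toLeavitt K n) g
  -- On the image of `M` the map `h` is the inclusion into `N`, hence injective there, and this
  -- suffices.
  have hinj : Function.Injective h := injective_of_tunit _ fun m hm => by
    have : g m = 0 := (TensorOver.lift_unit _ g m).symm.trans hm
    have : e.symm m = 0 := Subtype.ext this
    rw [(LinearEquiv.map_eq_zero_iff _).1 this, map_zero]
  have hsurj : Function.Surjective h := by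
    rw [← LinearMap.range_eq_top, eq_top_iff, ← hspan, Submodule.span_le]
    refine fun v hv => ⟨tunit K n M (e ⟨v, hv⟩), (TensorOver.lift_unit _ g _).trans ?_⟩
    simp [g]
  exact ⟨⟨M, hM⟩, ⟨LinearEquiv.ofBijective h ⟨hinj, hsurj⟩⟩⟩

theorem essSurj_fplFunctor (hn : 2 ≤ n) : (fplFunctor K n).EssSurj := by
  refine ⟨fun Y => ?_⟩
  have : Module.FinitePresentation (LeavittAlgebra K n) Y.obj := Y.property.1
  have := (isFiniteLength_iff_isNoetherian_isArtinian.1 Y.property.2).1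
  obtain ⟨V, _, hspan, hstable⟩ := exists_finite_stable_subspace (K := K) (n := n) Y.obj hn
  obtain ⟨M, ⟨e⟩⟩ := exists_tensor_equiv_of_stable V hspan hstable
  exact ⟨M, ⟨(isFPL (LeavittAlgebra K n)).isoMk e.toModuleIso⟩⟩

theorem isLocalization_fplFunctor (hn : 2 ≤ n) :
    (fplFunctor K n).IsLocalization (isLeavittTorsion K n).isoModSerre :=
  have := essSurj_fplFunctor (K := K) hn
  isLocalization_of_exists_rightFraction _ _ isInvertedBy_fplFunctor
    exists_rightFraction_fplFunctor exists_comp_eq_of_fplFunctor_map_eq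

end Functor

/-! ## Leavitt modules -/

section LeavittModules

variable {K : Type u} [Field K] {n : ℕ}

/-- The differences `f m - g m` are torsion, and a Leavitt module has no nonzero torsion elements.
Only the target needs to be a Leavitt module. -/
theorem injective_tensorMap {M M' : ModuleCat.{u} (LambdaStar K n)} (hM' : isLeavitt K n M') :
    Function.Injective (TensorOver.map (toLeavitt K n) :
      (M →ₗ[LambdaStar K n] M') → _) := by
  intro f g h
  have : Module.Finite K M' := hM'.1
  ext m
  exact sub_eq_zero.1 (eq_zero_of_torsion (K := K) hM'.2 (torsion_sub_of_map_eq h m))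

/-- The graph of `φ` is the graph of a map: its first projection is injective because `M'` has no
torsion, and surjective because `M` has no proper submodule with torsion quotient. -/
theorem surjective_tensorMap {M M' : ModuleCat.{u} (LambdaStar K n)} (hM : isLeavitt K n M)
    (hM' : isLeavitt K n M') :
    Function.Surjective (TensorOver.map (toLeavitt K n) :
      (M →ₗ[LambdaStar K n] M') → _) := by
  intro φ
  have : Module.Finite K M := hM.1
  have : Module.Finite K M' := hM'.1
  have hinj : Function.Injective (graphFst φ) := by
    refine (injective_iff_map_eq_zero _).2 fun x hx => ?_
    have h := (torsion_of_graphFst_eq_zero φ hx).map (T' := iotaAct (K := K) (n := n) M')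
      (V' := {0}) (graphSnd φ) (iotaAct_map _) (by rintro _ rfl; exact .mem rfl)
    exact Subtype.ext (Prod.ext hx (eq_zero_of_torsion (K := K) hM'.2 h))
  have hsurj : Function.Surjective (graphFst φ) :=
    LinearMap.range_eq_top.1
      (eq_top_of_torsionMod (K := K) hM.2 (torsionMod_range_graphFst φ))
  let e := LinearEquiv.ofBijective (graphFst φ) ⟨hinj, hsurj⟩
  refine ⟨graphSnd φ ∘ₗ e.symm.toLinearMap, TensorOver.ext_unit _ fun m => ?_⟩
  have h1 : (e.symm m).1.1 = m := e.apply_symm_apply m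
  have h2 := (e.symm m).2
  rw [mem_tensorGraph, h1] at h2
  exact h2.symm

/-- Extension of scalars to the Leavitt algebra on endomorphism algebras. -/
def tensorEndHom (M : ModuleCat.{u} (LambdaStar K n)) :
    Module.End (LambdaStar K n) M →ₐ[K]
      Module.End (LeavittAlgebra K n) ((leavittFunctor K n).obj M) where
  toFun f := TensorOver.map (toLeavitt K n) f
  map_one' := TensorOver.ext_unit _ fun _ => rfl
  map_mul' _ _ := TensorOver.ext_unit _ fun _ => rfl
  map_zero' := TensorOver.ext_unit _ fun _ => map_zero (tunit K n M)
  map_add' f g := TensorOver.ext_unit _ fun m => map_add (tunit K n M) (f m) (g m)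
  commutes' k := TensorOver.ext_unit _ fun m => by
    refine (map_smulₛₗ (tunit K n M) (algebraMap K _ k) m).trans ?_
    rw [toLeavitt_algebraMap]
    rfl

/-- Choose `a ∈ I*` with `π a = 1`. On a trivial subfactor `P / N` it acts by zero and by the
identity, forcing `P ≤ N`. -/
theorem isLeavitt_restrictScalars {A : Type u} [Ring A] [Algebra K A]
    (π : LambdaStar K n →ₐ[K] A)
    (hI : π '' (augIdeal K n : Set (LambdaStar K n)) = Set.univ) (M : ModuleCat.{u} A)
    (hM : isFiniteDim K A M) :
    isLeavitt K n
      ((ModuleCat.restrictScalars (π : LambdaStar K n →+* A)).obj M) := by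
  have : Module.Finite K M := hM
  constructor
  · let f : M →ₗ[K] (ModuleCat.restrictScalars (π : LambdaStar K n →+* A)).obj M :=
      { toFun := fun m => m
        map_add' := fun _ _ => rfl
        map_smul' := fun k m => by
          change algebraMap K A k • m = π (algebraMap K (LambdaStar K n) k) • m
          rw [AlgHom.commutes] }
    exact Module.Finite.of_surjective f fun m => ⟨m, rfl⟩
  · intro N P hNP hsimple
    by_contra hne
    rw [not_isEmpty_iff, nonempty_subfactor_equiv_iff] at hne
    have hcov := (covBy_iff_quot_is_simple hNP).2 hsimple
    obtain ⟨a, ha, ha1⟩ : (1 : A) ∈ π '' (augIdeal K n : Set (LambdaStar K n)) :=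
      hI ▸ Set.mem_univ _
    refine hcov.lt.not_ge fun p hp => ?_
    have h1 : a • p ∈ N :=
      augIdeal_le_iff (J := N.comap (LinearMap.toSpanSingleton (LambdaStar K n) _ p)).2
        (fun i => hne i p hp) ha
    have h2 : a • p = p := by
      change π a • (show M from p) = p
      rw [ha1, one_smul]
    rwa [h2] at h1

theorem exists_ofHom_restrictScalars {A : Type u} [Ring A] [Algebra K A]
    (π : LambdaStar K n →ₐ[K] A) (hπ : Function.Surjective π) {M M' : ModuleCat.{u} A}
    (f : (ModuleCat.restrictScalars (π : LambdaStar K n →+* A)).obj M →ₗ[LambdaStar K n]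
      (ModuleCat.restrictScalars (π : LambdaStar K n →+* A)).obj M') :
    ∃ g : M ⟶ M', (ModuleCat.restrictScalars (π : LambdaStar K n →+* A)).map g =
      ModuleCat.ofHom f := by
  refine ⟨ModuleCat.ofHom
    { toFun := fun m => f m
      map_add' := map_add f
      map_smul' := fun a m => ?_ }, rfl⟩
  obtain ⟨r, rfl⟩ := hπ a
  exact f.map_smul' r m

theorem full_restrictScalars_leavittFunctor {A : Type u} [Ring A] [Algebra K A]
    (π : LambdaStar K n →ₐ[K] A) (hπ : Function.Surjective π)
    (hI : π '' (augIdeal K n : Set (LambdaStar K n)) = Set.univ) :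
    ((isFiniteDim K A).ι ⋙ ModuleCat.restrictScalars (π : LambdaStar K n →+* A) ⋙
      leavittFunctor K n).Full where
  map_surjective {X Y} φ := by
    obtain ⟨f, hf⟩ := surjective_tensorMap (isLeavitt_restrictScalars π hI X.obj X.property)
      (isLeavitt_restrictScalars π hI Y.obj Y.property) φ.hom
    obtain ⟨g, hg⟩ := exists_ofHom_restrictScalars π hπ f
    refine ⟨ObjectProperty.homMk g, ?_⟩
    rw [Functor.comp_map, Functor.comp_map, ObjectProperty.ι_map, ObjectProperty.homMk_hom, hg]
    exact ModuleCat.hom_ext hf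

theorem faithful_restrictScalars_leavittFunctor {A : Type u} [Ring A] [Algebra K A]
    (π : LambdaStar K n →ₐ[K] A)
    (hI : π '' (augIdeal K n : Set (LambdaStar K n)) = Set.univ) :
    ((isFiniteDim K A).ι ⋙ ModuleCat.restrictScalars (π : LambdaStar K n →+* A) ⋙
      leavittFunctor K n).Faithful where
  map_injective {X Y} f g h := by
    have h' := injective_tensorMap (isLeavitt_restrictScalars π hI Y.obj Y.property)
      (congrArg ModuleCat.Hom.hom h)
    ext1
    exact (ModuleCat.restrictScalars (π : LambdaStar K n →+* A)).map_injective
      (ModuleCat.hom_ext h')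

end LeavittModules

end

theorem corollary3p10 (K : Type u) [Field K] (n : ℕ) (hn : 2 ≤ n) :
    ∃ hΦ : ∀ M : (isFiniteDim K (LambdaStar K n)).FullSubcategory,
        isFPL (LeavittAlgebra K n)
          (((isFiniteDim K (LambdaStar K n)).ι ⋙ leavittFunctor K n).obj M),
      -- the quotient category of the finite-dimensional modules by the Leavitt-torsion modules
      (∃ _ : (isLeavittTorsion K n).IsSerreClass,
        ((isFPL (LeavittAlgebra K n)).lift
            ((isFiniteDim K (LambdaStar K n)).ι ⋙ leavittFunctor K n) hΦ).IsLocalization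
          (isLeavittTorsion K n).isoModSerre) ∧
      -- the full embedding of the Leavitt category
      (ObjectProperty.ιOfLE (isLeavitt_le K n) ⋙
        (isFPL (LeavittAlgebra K n)).lift
          ((isFiniteDim K (LambdaStar K n)).ι ⋙ leavittFunctor K n) hΦ).Full ∧
      (ObjectProperty.ιOfLE (isLeavitt_le K n) ⋙
        (isFPL (LeavittAlgebra K n)).lift
          ((isFiniteDim K (LambdaStar K n)).ι ⋙ leavittFunctor K n) hΦ).Faithful ∧
      -- the isomorphism of endomorphism algebras
      (∀ M : ModuleCat.{u} (LambdaStar K n), isLeavitt K n M →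
        ∃ e : Module.End (LambdaStar K n) M ≃ₐ[K]
            Module.End (LeavittAlgebra K n) ((leavittFunctor K n).obj M),
          ∀ f : Module.End (LambdaStar K n) M,
            e f = ((leavittFunctor K n).map (ModuleCat.ofHom f)).hom) ∧
      -- the full embedding of the finite-dimensional modules over a finite-dimensional factor
      -- algebra onto which the augmentation ideal maps
      (∀ (A : Type u) [Ring A] [Algebra K A] [Module.Finite K A] (π : LambdaStar K n →ₐ[K] A),
        Function.Surjective π → π '' (augIdeal K n : Set (LambdaStar K n)) = Set.univ →
        ∃ hA : ∀ M : (isFiniteDim K A).FullSubcategory,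
            isFPL (LeavittAlgebra K n)
              (((isFiniteDim K A).ι ⋙
                ModuleCat.restrictScalars (π : LambdaStar K n →+* A) ⋙
                  leavittFunctor K n).obj M),
          ((isFPL (LeavittAlgebra K n)).lift
            ((isFiniteDim K A).ι ⋙
              ModuleCat.restrictScalars (π : LambdaStar K n →+* A) ⋙
                leavittFunctor K n) hA).Full ∧
          ((isFPL (LeavittAlgebra K n)).lift
            ((isFiniteDim K A).ι ⋙
              ModuleCat.restrictScalars (π : LambdaStar K n →+* A) ⋙
                leavittFunctor K n) hA).Faithful) := by
  refine ⟨isFPL_leavittFunctor, ⟨isLeavittTorsion_isSerreClass K n, isLocalization_fplFunctor hn⟩,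
    ⟨fun {X Y} φ => ?_⟩, ⟨fun {X Y} f g h => ?_⟩, fun M hM => ?_, ?_⟩
  · obtain ⟨f, hf⟩ := surjective_tensorMap X.property Y.property φ.hom.hom
    exact ⟨ObjectProperty.homMk (ModuleCat.ofHom f),
      ObjectProperty.hom_ext _ (ModuleCat.hom_ext hf)⟩
  · ext1
    exact ModuleCat.hom_ext
      (injective_tensorMap Y.property (congrArg (fun k => k.hom.hom) h))
  · exact ⟨AlgEquiv.ofBijective (tensorEndHom M)
      ⟨injective_tensorMap hM, surjective_tensorMap hM hM⟩, fun _ => rfl⟩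
  · intro A _ _ _ π hπ hI
    have hL := fun M : (isFiniteDim K A).FullSubcategory =>
      isLeavitt_restrictScalars π hI M.obj M.property
    exact ⟨fun M => isFPL_leavittFunctor ⟨_, (hL M).1⟩,
      have := full_restrictScalars_leavittFunctor π hπ hI
      inferInstance,
      have := faithful_restrictScalars_leavittFunctor π hI
      inferInstance⟩
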